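/- Let $k\ge 3$ and $n\ge 1$. The Sierpiński graph $S(n,k)$ has vertex set $\{1,\dots,k\}^n$, with $N_n=k^n$ vertices; $p=p_1\cdots p_n$ and $q=q_1\cdots q_n$ are adjacent if and only if there is $h\in\{1,\dots,n\}$ such that $p_i=q_i$ for $i<h$, $p_h\ne q_h$, and $p_i=q_h$, $q_i=p_h$ for $i>h$. Let $L$ be its Laplacian matrix, with eigenvalues $0=\lambda_1<\lambda_2\le\dots\le\lambda_{N_n}$, and put $$H_2(S(n,k))=\frac{1}{2N_n}\sum_{i=2}^{N_n}\frac{1}{\lambda_i^2}.$$ This is the second-order coherence of $S(n,k)$: whenever $(x(t),v(t))$ solves the noisy second-order consensus system $\dot x=v$, $\dot v=-Lx-Lv+w$, where $w$ is white noise of unit intensity whose components are mutually uncorrelated (that is, $w=\dot W$ with the components of $W$ mutually uncorrelated standard Brownian motions) and the initial state is square-integrable, the mean variance of the deviations from the average position satisfies $$\lim_{t\to\infty}\frac1{N_n}\sum_{i=1}^{N_n}\operatorname{Var}\Big(x_i(t)-\frac1{N_n}\sum_{j=1}^{N_n}x_j(t)\Big)=H_2(S(n,k)).$$ Moreover $$\begin{aligned}H_2(S(n,k))=&-\frac{7k^2+13k+2}{2k^{n+1}(k+1)^2(k+2)^2(k+3)}-\frac{(k-2)(k^3+4k^2+4k+2)}{2k^2(k+2)^2(k^2+3k+4)}\\&+\frac{(k-1)(k+2)^{n-2}(k^2+k+2)}{2k^{n+1}(k+1)^2}\\&+\frac{k^5+7k^4+16k^3+28k^2+26k+12}{2k^{n+2}(k+1)^2(k+3)(k^2+3k+4)}\,(k-1)(k+2)^{2n-2},\end{aligned}$$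 and, for fixed $k$ and $n\to\infty$, $$H_2(S(n,k))\sim h(k)\,N_n^{\frac{2\log(k+2)}{\log k}-1},\qquad h(k)=\frac{(k^5+7k^4+16k^3+28k^2+26k+12)(k-1)}{2k^2(k+1)^2(k+2)^2(k+3)(k^2+3k+4)},$$ meaning that the ratio of the two sides tends to $1$. -/

import Mathlib

open MeasureTheory ProbabilityTheory Filter Asymptotics
open scoped NNReal Topology

/-- The Sierpiński graph `S(n,k)`: the vertices are the words of length `n` over an alphabet with
`k` letters; `p` and `q` are adjacent iff for some position `h` they agree before `h`, differ at
`h`, and after `h` all letters of `p` equal `q h` and all letters of `q` equal `p h`. -/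
def sierpinskiGraph (n k : ℕ) : SimpleGraph (Fin n → Fin k) where
  Adj p q := ∃ h : Fin n, (∀ i, i < h → p i = q i) ∧ p h ≠ q h ∧
    ∀ i, h < i → p i = q h ∧ q i = p h
  symm := ⟨by
    rintro p q ⟨h, h1, h2, h3⟩
    exact ⟨h, fun i hi => (h1 i hi).symm, h2.symm, fun i hi => (h3 i hi).symm⟩⟩
  loopless := ⟨by
    rintro p ⟨h, -, h2, -⟩
    exact h2 rfl⟩

instance (n k : ℕ) : DecidableRel (sierpinskiGraph n k).Adj := fun p q =>
  inferInstanceAs (Decidable (∃ h : Fin n, (∀ i, i < h → p i = q i) ∧ p h ≠ q h ∧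
    ∀ i, h < i → p i = q h ∧ q i = p h))

/-- `H₂(G) = (1 / (2N)) ∑ 1 / λ²`, the sum running over the nonzero eigenvalues `λ` of the
Laplacian matrix of `G`, counted with multiplicity. -/
noncomputable def secondOrderCoherence {V : Type*} [Fintype V] [DecidableEq V]
    (G : SimpleGraph V) [DecidableRel G.Adj] : ℝ :=
  1 / (2 * (Fintype.card V : ℝ)) *
    ∑ i ∈ Finset.univ.filter (fun i => (G.isHermitian_lapMatrix ℝ).eigenvalues i ≠ 0),
      1 / ((G.isHermitian_lapMatrix ℝ).eigenvalues i) ^ 2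

/-- `W` is the time integral of a mutually uncorrelated white noise of unit intensity: one standard
Brownian motion for every vertex, different ones being uncorrelated. -/
structure IsIntegratedWhiteNoise {V Ω : Type*} [MeasurableSpace Ω] (P : Measure Ω)
    (W : V → ℝ≥0 → Ω → ℝ) : Prop where
  brownian : ∀ i, IsBrownianReal (W i) P
  uncorrelated : ∀ i j, i ≠ j → ∀ s t, cov[W i s, W j t; P] = 0

/-- The positions `x` and velocities `v` solve `x' = v`, `v' = -L x - L v + W'` with `L` the
Laplacian matrix of `G` (in integrated form, the noise being additive), with continuous paths and
square-integrable initial states. -/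
structure IsSecondOrderNoisyConsensus {V Ω : Type*} [Fintype V] [DecidableEq V]
    [MeasurableSpace Ω] (G : SimpleGraph V) [DecidableRel G.Adj] (P : Measure Ω)
    (W : V → ℝ≥0 → Ω → ℝ) (x v : ℝ≥0 → Ω → V → ℝ) : Prop where
  measurable_x : ∀ t, Measurable (x t)
  measurable_v : ∀ t, Measurable (v t)
  memLp_x : ∀ i, MemLp (fun ω => x 0 ω i) 2 P
  memLp_v : ∀ i, MemLp (fun ω => v 0 ω i) 2 P
  continuous_x : ∀ᵐ ω ∂P, Continuous fun t => x t ω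
  continuous_v : ∀ᵐ ω ∂P, Continuous fun t => v t ω
  eq_x : ∀ᵐ ω ∂P, ∀ (t : ℝ≥0) (i : V),
    x t ω i = x 0 ω i + ∫ s in (0 : ℝ)..t, v s.toNNReal ω i
  eq_v : ∀ᵐ ω ∂P, ∀ (t : ℝ≥0) (i : V),
    v t ω i = v 0 ω i +
      (∫ s in (0 : ℝ)..t, (-((G.lapMatrix ℝ).mulVec (x s.toNNReal ω) i)
        - (G.lapMatrix ℝ).mulVec (v s.toNNReal ω) i)) + W i t ω

/-- The mean over all vertices of the variance, at time `t`, of the deviation of the position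
`x_i(t)` from the average of all positions. -/
noncomputable def meanDeviationVariance {V Ω : Type*} [Fintype V] [MeasurableSpace Ω]
    (P : Measure Ω) (x : ℝ≥0 → Ω → V → ℝ) (t : ℝ≥0) : ℝ :=
  1 / (Fintype.card V : ℝ) *
    ∑ i, Var[fun ω => x t ω i - 1 / (Fintype.card V : ℝ) * ∑ j, x t ω j; P]

/-- The explicit value of the second-order coherence of `S(n,k)`. -/
noncomputable def sierpinskiClosedForm (n : ℕ) (k : ℝ) : ℝ :=
  -((7 * k ^ 2 + 13 * k + 2) /
      (2 * k ^ (n + 1) * (k + 1) ^ 2 * (k + 2) ^ 2 * (k + 3)))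
    - ((k - 2) * (k ^ 3 + 4 * k ^ 2 + 4 * k + 2)) /
      (2 * k ^ 2 * (k + 2) ^ 2 * (k ^ 2 + 3 * k + 4))
    + ((k - 1) * (k + 2) ^ ((n : ℤ) - 2) * (k ^ 2 + k + 2)) /
      (2 * k ^ (n + 1) * (k + 1) ^ 2)
    + (k ^ 5 + 7 * k ^ 4 + 16 * k ^ 3 + 28 * k ^ 2 + 26 * k + 12) /
      (2 * k ^ (n + 2) * (k + 1) ^ 2 * (k + 3) * (k ^ 2 + 3 * k + 4))
      * ((k - 1) * (k + 2) ^ (2 * (n : ℤ) - 2))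

/-- The coefficient `h(k)` of the leading term. -/
noncomputable def sierpinskiLeadingCoeff (k : ℝ) : ℝ :=
  ((k ^ 5 + 7 * k ^ 4 + 16 * k ^ 3 + 28 * k ^ 2 + 26 * k + 12) * (k - 1)) /
    (2 * k ^ 2 * (k + 1) ^ 2 * (k + 2) ^ 2 * (k + 3) * (k ^ 2 + 3 * k + 4))

/-! A word `pa` of length `n + 1` is read as the half-edge with label `a` at the vertex `p` of
`S(n,k)`. The involution `dartFlip` exchanges the two halves of each edge; its fixed points are the
`k` constant words, which serve as loose ends. Every vertex thus has exactly `k` half-edges, and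
`S(n+1,k)` arises from `S(n,k)` by replacing each vertex with the clique on its half-edges.

In matrix terms, let `B` be the incidence of vertices with half-edges and `T` the permutation matrix
of `dartFlip`. Then `L_{n+1} = (k+1) I - Bᵀ B - T`, with `B Bᵀ = k I`, `T² = I` and `B T Bᵀ = k I -
L_n`. Sylvester's determinant identity expresses `det(w + L_{n+1})` through `det(w(w+k+2) + L_n)`
and powers of `w+k` and `w+k+2` (`det_smul_one_add_lapMatrix_succ`). After the simple zero at `w =
0` is cancelled, the first two derivatives of the logarithm at `0` give linear recursions for the
sums of `1/λ` and `1/λ²` (`inverse_eigenvalue_sum_recursion`). Their solution from the one-vertex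
graph `n = 0` is the closed form, and the asymptotics follow from its dominant exponential.

For the dynamics, projection to an eigenvector of eigenvalue `l > 0` gives a damped oscillator `y''
= -l y - l y'` driven by white noise. If `K` is its impulse response and `M = K'`, integration by
parts turns the noise term into the pathwise integral of `M(t-s) W(s)`, so no stochastic integral is
needed and only second moments of `W` enter. Its variance is the integral of `K²` over `[0,t]`,
which tends to `1/(2l²)`, while the influence of the initial state dies out
(`noisyOscillator_tendsto_variance`). The deviation from the average is the part of the state
orthogonal to the kernel of `L`, so its variances sum to those of the modes with `l ≠ 0`. -/

/-! ### Half-edges and the recursive structure of the graphs. -/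

/-- The words `p` and `q` are joined by an edge of the Sierpiński graph at position `h`. -/
def SierpinskiEdge {n k : ℕ} (h : Fin n) (p q : Fin n → Fin k) : Prop :=
  (∀ i, i < h → p i = q i) ∧ p h ≠ q h ∧ ∀ i, h < i → p i = q h ∧ q i = p h

theorem SierpinskiEdge.symm {n k : ℕ} {h : Fin n} {p q : Fin n → Fin k}
    (e : SierpinskiEdge h p q) : SierpinskiEdge h q p :=
  ⟨fun i hi => (e.1 i hi).symm, e.2.1.symm, fun i hi => (e.2.2 i hi).symm⟩

theorem sierpinskiGraph_adj_iff {n k : ℕ} {p q : Fin n → Fin k} :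
    (sierpinskiGraph n k).Adj p q ↔ ∃ h, SierpinskiEdge h p q := Iff.rfl

/-- The positions at which a nonempty word differs from its last letter. -/
def breakSet {n k : ℕ} (q : Fin (n + 1) → Fin k) : Finset (Fin (n + 1)) :=
  Finset.univ.filter fun i => q i ≠ q (Fin.last n)

/-- The other end of the edge leaving `q` and not contained in the block of the words that share
all letters but the last with `q`; the word `q` itself if there is no such edge. -/
def dartFlip {n k : ℕ} (q : Fin (n + 1) → Fin k) : Fin (n + 1) → Fin k :=
  if hq : (breakSet q).Nonempty then fun i =>
    if i < (breakSet q).max' hq then q i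
    else if i = (breakSet q).max' hq then q (Fin.last n) else q ((breakSet q).max' hq)
  else q

theorem breakSet_not_nonempty {n k : ℕ} {q : Fin (n + 1) → Fin k}
    (hq : ∀ i, q i = q (Fin.last n)) : ¬ (breakSet q).Nonempty := by
  simp [breakSet, hq]

theorem dartFlip_of_const {n k : ℕ} {q : Fin (n + 1) → Fin k}
    (hq : ∀ i, q i = q (Fin.last n)) : dartFlip q = q := by
  rw [dartFlip, dif_neg (breakSet_not_nonempty hq)]

theorem dartFlip_eq_of_edge {n k : ℕ} {h : Fin (n + 1)} {q r : Fin (n + 1) → Fin k}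
    (hh : h < Fin.last n) (e : SierpinskiEdge h q r) : dartFlip q = r := by
  have h1 : q (Fin.last n) = r h := (e.2.2 _ hh).1
  have hmem : h ∈ breakSet q := by simp [breakSet, h1, e.2.1]
  have hne : (breakSet q).Nonempty := ⟨h, hmem⟩
  have hmax : (breakSet q).max' hne = h := by
    refine le_antisymm (Finset.max'_le _ _ _ fun i hi => ?_) (Finset.le_max' _ _ hmem)
    by_contra hlt
    have := (e.2.2 i (not_le.1 hlt)).1
    simp [breakSet, h1, this] at hi
  rw [dartFlip, dif_pos hne, hmax]
  funext i
  rcases lt_trichotomy i h with hi | hi | hi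
  · simp [hi, e.1 i hi]
  · simp [hi, h1]
  · simp [hi.not_gt, hi.ne', (e.2.2 i hi).2]

theorem const_or_exists_edge_dartFlip {n k : ℕ} (q : Fin (n + 1) → Fin k) :
    (∀ i, q i = q (Fin.last n)) ∨ ∃ h < Fin.last n, SierpinskiEdge h q (dartFlip q) := by
  by_cases hne : (breakSet q).Nonempty
  · right
    have hm := Finset.max'_mem _ hne
    set h := (breakSet q).max' hne with hh
    have hqh : q h ≠ q (Fin.last n) := by simpa [breakSet] using hm
    have hab : ∀ i, h < i → q i = q (Fin.last n) := by
      intro i hi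
      by_contra hc
      exact (Finset.le_max' (breakSet q) i (by simp [breakSet, hc])).not_gt hi
    refine ⟨h, lt_of_le_of_ne (Fin.le_last _) fun hl => hqh (by rw [hl]), ?_, ?_, ?_⟩
    · intro i hi
      simp [dartFlip, hne, ← hh, hi]
    · simpa [dartFlip, hne, ← hh] using hqh
    · intro i hi
      simp [dartFlip, hne, ← hh, hi.not_gt, hi.ne', hab i hi]
  · left
    intro i
    by_contra hc
    exact hne ⟨i, by simp [breakSet, hc]⟩

theorem dartFlip_dartFlip {n k : ℕ} (q : Fin (n + 1) → Fin k) : dartFlip (dartFlip q) = q := by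
  rcases const_or_exists_edge_dartFlip q with h | ⟨h, hh, e⟩
  · rw [dartFlip_of_const h, dartFlip_of_const h]
  · exact dartFlip_eq_of_edge hh e.symm

theorem dartFlip_eq_self_iff {n k : ℕ} {q : Fin (n + 1) → Fin k} :
    dartFlip q = q ↔ ∀ i, q i = q (Fin.last n) := by
  refine ⟨fun hq => ?_, dartFlip_of_const⟩
  rcases const_or_exists_edge_dartFlip q with h | ⟨h, hh, e⟩
  · exact h
  · exact absurd (by rw [hq]) e.2.1

theorem sierpinskiEdge_last_iff {n k : ℕ} {p q : Fin (n + 1) → Fin k} :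
    SierpinskiEdge (Fin.last n) p q ↔ Fin.init p = Fin.init q ∧ p ≠ q := by
  constructor
  · rintro ⟨h1, h2, -⟩
    exact ⟨funext fun i => h1 _ (Fin.castSucc_lt_last i), fun h => h2 (by rw [h])⟩
  · rintro ⟨h1, h2⟩
    have h1' : ∀ i : Fin n, p i.castSucc = q i.castSucc := fun i => congrFun h1 i
    refine ⟨fun i hi => ?_, fun h => h2 ?_, fun i hi => absurd hi (Fin.le_last i).not_gt⟩
    · obtain ⟨j, rfl⟩ := Fin.exists_castSucc_eq.2 hi.ne
      exact h1' j
    · funext i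
      induction i using Fin.lastCases with
      | last => exact h
      | cast j => exact h1' j

/-- An edge at the last position stays inside a clique; an edge at an earlier position is a flip. -/
theorem sierpinskiGraph_succ_adj_iff {n k : ℕ} {p q : Fin (n + 1) → Fin k} :
    (sierpinskiGraph (n + 1) k).Adj p q ↔
      p ≠ q ∧ (Fin.init p = Fin.init q ∨ dartFlip p = q) := by
  rw [sierpinskiGraph_adj_iff]
  constructor
  · rintro ⟨h, e⟩
    refine ⟨fun hpq => e.2.1 (by rw [hpq]), ?_⟩
    rcases (Fin.le_last h).eq_or_lt with rfl | hl
    · exact Or.inl (sierpinskiEdge_last_iff.1 e).1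
    · exact Or.inr (dartFlip_eq_of_edge hl e)
  · rintro ⟨hne, h | h⟩
    · exact ⟨_, sierpinskiEdge_last_iff.2 ⟨h, hne⟩⟩
    · rcases const_or_exists_edge_dartFlip p with hc | ⟨i, -, e⟩
      · exact absurd ((dartFlip_of_const hc).symm.trans h) hne
      · exact ⟨i, h ▸ e⟩

/-- A flip that moves a word changes a letter before the last, so it leaves the clique. The two
kinds of adjacency are therefore disjoint and their indicator matrices add up. -/
theorem eq_of_init_eq_of_dartFlip_eq {n k : ℕ} {p q : Fin (n + 1) → Fin k}
    (h : Fin.init p = Fin.init q) (h' : dartFlip p = q) : p = q := by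
  rcases const_or_exists_edge_dartFlip p with hc | ⟨i, hi, e⟩
  · rw [← h', dartFlip_of_const hc]
  · rw [h'] at e
    obtain ⟨j, rfl⟩ := Fin.exists_castSucc_eq.2 hi.ne
    exact absurd (congrFun h j) e.2.1

theorem SierpinskiEdge.init {n k : ℕ} {h : Fin n} {p q : Fin (n + 1) → Fin k}
    (e : SierpinskiEdge h.castSucc p q) : SierpinskiEdge h (Fin.init p) (Fin.init q) :=
  ⟨fun i hi => e.1 i.castSucc (by simpa using hi), e.2.1,
    fun i hi => e.2.2 i.castSucc (by simpa using hi)⟩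

theorem SierpinskiEdge.snoc {n k : ℕ} {h : Fin n} {p q : Fin n → Fin k}
    (e : SierpinskiEdge h p q) :
    SierpinskiEdge h.castSucc (Fin.snoc p (q h) : Fin (n + 1) → Fin k) (Fin.snoc q (p h)) := by
  refine ⟨fun i hi => ?_, by simpa using e.2.1, fun i hi => ?_⟩
  · obtain ⟨j, rfl⟩ := Fin.exists_castSucc_eq.2 (hi.trans (Fin.castSucc_lt_last h)).ne
    simpa using e.1 j (by simpa using hi)
  · induction i using Fin.lastCases with
    | last => simp
    | cast j => simpa using e.2.2 j (by simpa using hi)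

theorem SierpinskiEdge.position_unique {n k : ℕ} {h h' : Fin n} {p q : Fin n → Fin k}
    (e : SierpinskiEdge h p q) (e' : SierpinskiEdge h' p q) : h = h' := by
  rcases lt_trichotomy h h' with hl | hl | hl
  · exact absurd (e'.1 h hl) e.2.1
  · exact hl
  · exact absurd (e.1 h' hl) e'.2.1

theorem init_dartFlip_snoc_eq_iff {n k : ℕ} {p q : Fin n → Fin k} (hpq : p ≠ q) (a : Fin k) :
    Fin.init (dartFlip (Fin.snoc p a : Fin (n + 1) → Fin k)) = q ↔
      ∃ h, SierpinskiEdge h p q ∧ a = q h := by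
  constructor
  · intro hq
    rcases const_or_exists_edge_dartFlip (Fin.snoc p a : Fin (n + 1) → Fin k) with hc | ⟨h, hh, e⟩
    · rw [dartFlip_of_const hc, Fin.init_snoc] at hq
      exact absurd hq hpq
    · obtain ⟨j, rfl⟩ := Fin.exists_castSucc_eq.2 hh.ne
      refine ⟨j, ?_, ?_⟩
      · simpa [hq] using e.init
      · have := (e.2.2 _ hh).1
        rw [Fin.snoc_last] at this
        rw [this, ← hq]
        rfl
  · rintro ⟨h, e, rfl⟩
    rw [dartFlip_eq_of_edge (Fin.castSucc_lt_last h) e.snoc, Fin.init_snoc]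

/-- An edge determines its position `h`, and the half at `p` then carries the label `q h`, so two
distinct vertices are linked by at most one half-edge of `p`. -/
theorem card_init_dartFlip_snoc {n k : ℕ} {p q : Fin n → Fin k} (hpq : p ≠ q) :
    (Finset.univ.filter fun a : Fin k =>
      Fin.init (dartFlip (Fin.snoc p a : Fin (n + 1) → Fin k)) = q).card =
      if (sierpinskiGraph n k).Adj p q then 1 else 0 := by
  split_ifs with h
  · obtain ⟨h, e⟩ := sierpinskiGraph_adj_iff.1 h
    rw [Finset.card_eq_one]
    refine ⟨q h, ?_⟩
    ext a
    rw [Finset.mem_filter_univ, Finset.mem_singleton, init_dartFlip_snoc_eq_iff hpq]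
    constructor
    · rintro ⟨h', e', rfl⟩
      rw [e'.position_unique e]
    · rintro rfl
      exact ⟨h, e, rfl⟩
  · rw [Finset.card_eq_zero, Finset.filter_eq_empty_iff]
    intro a _ ha
    obtain ⟨h', e', -⟩ := (init_dartFlip_snoc_eq_iff hpq a).1 ha
    exact h ⟨h', e'⟩

/-- Connectedness, in the form used for the kernel of the Laplacian. A function constant along edges
is constant on cliques, hence descends to the shorter words. -/
theorem eq_of_forall_sierpinskiGraph_adj {k : ℕ} (n : ℕ) (f : (Fin n → Fin k) → ℝ)
    (hf : ∀ p q, (sierpinskiGraph n k).Adj p q → f p = f q) (p q : Fin n → Fin k) :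
    f p = f q := by
  induction n with
  | zero => rw [Subsingleton.elim p q]
  | succ n ih =>
    have hblock : ∀ p q : Fin (n + 1) → Fin k, Fin.init p = Fin.init q → f p = f q := by
      intro p q h
      by_cases hpq : p = q
      · rw [hpq]
      · exact hf _ _ (sierpinskiGraph_succ_adj_iff.2 ⟨hpq, Or.inl h⟩)
    have a : Fin k := p (Fin.last n)
    have := ih (fun r => f (Fin.snoc r a)) (fun r s hrs => ?_) (Fin.init p) (Fin.init q)
    · calc f p = f (Fin.snoc (Fin.init p) a) := hblock _ _ (by simp)
        _ = f (Fin.snoc (Fin.init q) a) := this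
        _ = f q := hblock _ _ (by simp)
    · obtain ⟨h, e⟩ := sierpinskiGraph_adj_iff.1 hrs
      calc f (Fin.snoc r a) = f (Fin.snoc r (s h)) := hblock _ _ (by simp)
        _ = f (Fin.snoc s (r h)) := hf _ _ ⟨_, e.snoc⟩
        _ = f (Fin.snoc s a) := hblock _ _ (by simp)

/-! ### Matrix identities and the determinant recursion. -/

/-- The incidence matrix of the words of length `n` and their one-letter extensions. -/
def blockMatrix (n k : ℕ) : Matrix (Fin n → Fin k) (Fin (n + 1) → Fin k) ℝ :=
  Matrix.of fun p q => if Fin.init q = p then 1 else 0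

/-- The permutation matrix of `dartFlip`. -/
def flipMatrix (n k : ℕ) : Matrix (Fin (n + 1) → Fin k) (Fin (n + 1) → Fin k) ℝ :=
  Matrix.of fun p q => if dartFlip p = q then 1 else 0

section matrices
open Matrix

variable (n k : ℕ)

theorem sum_word_succ {M : Type*} [AddCommMonoid M] (f : (Fin (n + 1) → Fin k) → M) :
    ∑ q, f q = ∑ p : Fin n → Fin k, ∑ a, f (Fin.snoc p a) := by
  rw [← Fintype.sum_prod_type', ← (Fin.snocEquiv fun _ : Fin (n + 1) => Fin k).sum_comp,
    ← (Equiv.prodComm _ _).sum_comp]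
  rfl

theorem flipMatrix_mul_self : flipMatrix n k * flipMatrix n k = 1 := by
  ext p q
  simp only [flipMatrix, Matrix.mul_apply, Matrix.of_apply]
  rw [Finset.sum_eq_single (dartFlip p) (by intro r _ hr; simp [hr.symm]) (by simp)]
  simp [dartFlip_dartFlip, Matrix.one_apply]

theorem flipMatrix_transpose : (flipMatrix n k)ᵀ = flipMatrix n k := by
  ext p q
  simp only [flipMatrix, Matrix.transpose_apply, Matrix.of_apply]
  congr 1
  rw [eq_iff_iff]
  constructor <;> rintro rfl <;> exact dartFlip_dartFlip _

theorem flipMatrix_isHermitian : (flipMatrix n k).IsHermitian := by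
  rw [Matrix.IsHermitian, Matrix.conjTranspose_eq_transpose_of_trivial, flipMatrix_transpose]

/-- The fixed points of the flip are the constant words, one for each letter. -/
theorem trace_flipMatrix : (flipMatrix n k).trace = k := by
  simp only [Matrix.trace, Matrix.diag, flipMatrix, Matrix.of_apply, dartFlip_eq_self_iff]
  rw [Finset.sum_boole]
  congr 1
  conv_rhs => rw [← Fintype.card_fin k, ← Finset.card_univ]
  refine Finset.card_bij (fun q _ => q (Fin.last n)) (fun _ _ => Finset.mem_univ _) ?_ ?_
  · intro q hq r hr h
    simp only [Finset.mem_filter_univ] at hq hr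
    funext i
    rw [hq, hr, h]
  · intro a _
    exact ⟨fun _ => a, by simp, rfl⟩

theorem blockMatrix_mul_transpose :
    blockMatrix n k * (blockMatrix n k)ᵀ = (k : ℝ) • (1 : Matrix _ _ ℝ) := by
  ext p q
  simp only [blockMatrix, Matrix.mul_apply, Matrix.transpose_apply, Matrix.of_apply,
    sum_word_succ, Fin.init_snoc, Matrix.smul_apply, Matrix.one_apply]
  rw [Finset.sum_eq_single p (by intro r _ hr; simp [hr]) (by simp)]
  simp

theorem transpose_blockMatrix_mul_apply (p q : Fin (n + 1) → Fin k) :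
    ((blockMatrix n k)ᵀ * blockMatrix n k) p q = if Fin.init p = Fin.init q then 1 else 0 := by
  simp [blockMatrix, Matrix.mul_apply, eq_comm]

theorem sierpinskiGraph_succ_adj_boole (p q : Fin (n + 1) → Fin k) :
    (if (sierpinskiGraph (n + 1) k).Adj p q then (1 : ℝ) else 0) =
      ((blockMatrix n k)ᵀ * blockMatrix n k) p q + flipMatrix n k p q - (1 : Matrix _ _ ℝ) p q
        - if p = q then flipMatrix n k p p else 0 := by
  rw [transpose_blockMatrix_mul_apply, Matrix.one_apply]
  simp only [flipMatrix, Matrix.of_apply, sierpinskiGraph_succ_adj_iff]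
  by_cases hpq : p = q
  · subst hpq; simp
  · by_cases h1 : Fin.init p = Fin.init q
    · have h2 : dartFlip p ≠ q := fun h2 => hpq (eq_of_init_eq_of_dartFlip_eq h1 h2)
      simp [hpq, h1, h2]
    · simp [hpq, h1]

theorem sum_transpose_blockMatrix_mul (p : Fin (n + 1) → Fin k) :
    ∑ q, ((blockMatrix n k)ᵀ * blockMatrix n k) p q = k := by
  simp only [transpose_blockMatrix_mul_apply, sum_word_succ, Fin.init_snoc]
  rw [Finset.sum_eq_single (Fin.init p) (by intro r _ hr; simp [hr.symm]) (by simp)]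
  simp

/-- Degrees are `k` except at constant words, which lack the flip edge. The diagonal of the flip
matrix corrects the degree matrix and the adjacency matrix alike, and cancels in their difference.
-/
theorem lapMatrix_sierpinskiGraph_succ :
    (sierpinskiGraph (n + 1) k).lapMatrix ℝ =
      ((k : ℝ) + 1) • (1 : Matrix _ _ ℝ) - (blockMatrix n k)ᵀ * blockMatrix n k
        - flipMatrix n k := by
  ext p q
  have hdeg : ((sierpinskiGraph (n + 1) k).degree p : ℝ) = k - flipMatrix n k p p := by
    rw [SimpleGraph.degree_eq_sum_if_adj]
    simp only [sierpinskiGraph_succ_adj_boole, Finset.sum_sub_distrib, Finset.sum_add_distrib,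
      sum_transpose_blockMatrix_mul]
    simp [flipMatrix, Matrix.one_apply]
  simp only [SimpleGraph.lapMatrix, SimpleGraph.degMatrix, Matrix.sub_apply,
    SimpleGraph.adjMatrix_apply, sierpinskiGraph_succ_adj_boole, Matrix.smul_apply,
    Matrix.diagonal_apply, hdeg, Matrix.one_apply]
  by_cases hpq : p = q
  · subst hpq; simp; ring
  · simp [hpq]; ring

theorem blockMatrix_mul_flipMatrix_mul_apply (p q : Fin n → Fin k) :
    (blockMatrix n k * flipMatrix n k * (blockMatrix n k)ᵀ) p q =
      (Finset.univ.filter fun a : Fin k =>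
        Fin.init (dartFlip (Fin.snoc p a : Fin (n + 1) → Fin k)) = q).card := by
  have h1 : ∀ r, (flipMatrix n k * (blockMatrix n k)ᵀ) r q =
      if Fin.init (dartFlip r) = q then 1 else 0 := by
    intro r
    simp only [flipMatrix, blockMatrix, Matrix.mul_apply, Matrix.of_apply, Matrix.transpose_apply]
    rw [Finset.sum_eq_single (dartFlip r) (by intro s _ hs; simp [hs.symm]) (by simp)]
    simp
  rw [Matrix.mul_assoc, Matrix.mul_apply]
  simp only [h1, sum_word_succ]
  simp only [blockMatrix, Matrix.of_apply, Fin.init_snoc]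
  rw [Finset.sum_eq_single p (by intro r _ hr; simp [hr]) (by simp)]
  simp

/-- Entries count the half-edges at `p` whose partner sits at `q`. Each row sums to `k`, so the
loose ends on the diagonal make up exactly for the missing degrees. -/
theorem blockMatrix_mul_flipMatrix_mul :
    blockMatrix n k * flipMatrix n k * (blockMatrix n k)ᵀ =
      (k : ℝ) • (1 : Matrix _ _ ℝ) - (sierpinskiGraph n k).lapMatrix ℝ := by
  have hoff : ∀ p q, p ≠ q → (blockMatrix n k * flipMatrix n k * (blockMatrix n k)ᵀ) p q =
      if (sierpinskiGraph n k).Adj p q then 1 else 0 := by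
    intro p q hpq
    rw [blockMatrix_mul_flipMatrix_mul_apply, card_init_dartFlip_snoc hpq]
    split_ifs <;> simp
  have hsum : ∀ p, ∑ q, (blockMatrix n k * flipMatrix n k * (blockMatrix n k)ᵀ) p q = k := by
    intro p
    simp only [blockMatrix_mul_flipMatrix_mul_apply]
    rw [← Nat.cast_sum, Finset.sum_card_fiberwise_eq_card_filter]
    simp
  have hdiag : ∀ p, (blockMatrix n k * flipMatrix n k * (blockMatrix n k)ᵀ) p p =
      k - (sierpinskiGraph n k).degree p := by
    intro p
    rw [← hsum p, SimpleGraph.degree_eq_sum_if_adj, ← Finset.sum_sub_distrib,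
      Finset.sum_eq_single p]
    · simp
    · intro q _ hq
      rw [hoff p q hq.symm, sub_self]
    · simp
  ext p q
  simp only [SimpleGraph.lapMatrix, SimpleGraph.degMatrix, Matrix.sub_apply,
    SimpleGraph.adjMatrix_apply, Matrix.smul_apply, Matrix.diagonal_apply, Matrix.one_apply]
  by_cases hpq : p = q
  · subst hpq; simp [hdiag]
  · simp [hpq, hoff]

/-- The determinant of a shifted symmetric matrix is the product of the shifted eigenvalues. -/
theorem Matrix.IsHermitian.det_smul_one_add {ι : Type*} [Fintype ι] [DecidableEq ι]
    {A : Matrix ι ι ℝ} (hA : A.IsHermitian) (w : ℝ) :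
    (w • (1 : Matrix ι ι ℝ) + A).det = ∏ i, (w + hA.eigenvalues i) := by
  have h := congrArg (Polynomial.eval (-w)) hA.charpoly_eq
  rw [Matrix.eval_charpoly, Polynomial.eval_prod] at h
  simp only [Polynomial.eval_sub, Polynomial.eval_X, Polynomial.eval_C] at h
  have h2 : w • (1 : Matrix ι ι ℝ) + A = -(Matrix.scalar ι (-w) - A) := by
    rw [Matrix.scalar_apply, ← Matrix.smul_one_eq_diagonal, neg_smul]
    abel
  rw [h2, Matrix.det_neg, h, ← Finset.card_univ, ← Finset.prod_const, ← Finset.prod_mul_distrib]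
  refine Finset.prod_congr rfl fun i _ => ?_
  simp
  ring

theorem exists_det_smul_one_sub_flipMatrix : ∃ a b : ℕ, a + b = k ^ (n + 1) ∧ (a : ℝ) - b = k ∧
    ∀ z : ℝ, (z • (1 : Matrix _ _ ℝ) - flipMatrix n k).det = (z - 1) ^ a * (z + 1) ^ b := by
  have hT := flipMatrix_isHermitian n k
  -- The flip matrix squares to the identity. The exponents `a` and `b` are the multiplicities of
  -- `1` and `-1`: their sum is the dimension, their difference the trace.
  have hsq : ∀ i, hT.eigenvalues i = 1 ∨ hT.eigenvalues i = -1 := by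
    intro i
    have h1 := hT.mulVec_eigenvectorBasis i
    have h2 : flipMatrix n k *ᵥ (flipMatrix n k *ᵥ ⇑(hT.eigenvectorBasis i)) =
        ⇑(hT.eigenvectorBasis i) := by
      rw [Matrix.mulVec_mulVec, flipMatrix_mul_self, Matrix.one_mulVec]
    rw [h1, Matrix.mulVec_smul, h1, smul_smul] at h2
    have hne : (⇑(hT.eigenvectorBasis i) : (Fin (n + 1) → Fin k) → ℝ) ≠ 0 := by
      intro h0
      exact hT.eigenvectorBasis.toBasis.ne_zero i (by ext j; simpa using congrFun h0 j)
    obtain ⟨j, hj⟩ := Function.ne_iff.1 hne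
    have h3 := congrFun h2 j
    simp only [Pi.smul_apply, smul_eq_mul] at h3
    have h4 : hT.eigenvalues i * hT.eigenvalues i = 1 := mul_right_cancel₀ hj (by rw [h3, one_mul])
    exact mul_self_eq_one_iff.1 h4
  refine ⟨(Finset.univ.filter fun i => hT.eigenvalues i = 1).card,
    (Finset.univ.filter fun i => ¬ hT.eigenvalues i = 1).card, ?_, ?_, fun z => ?_⟩
  · rw [Finset.card_filter_add_card_filter_not]
    simp
  · have h := hT.trace_eq_sum_eigenvalues
    rw [trace_flipMatrix, ← Finset.sum_filter_add_sum_filter_not _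
      (fun i => hT.eigenvalues i = 1)] at h
    rw [h, Finset.sum_congr rfl (g := fun _ => (1 : ℝ)), Finset.sum_congr (s₁ := Finset.univ.filter
      fun i => ¬ hT.eigenvalues i = 1) rfl (g := fun _ => (-1 : ℝ))]
    · simp [sub_eq_add_neg]
    · intro i hi
      simpa using (hsq i).resolve_left (by simpa using hi)
    · intro i hi
      simpa using hi
  · have h2 : z • (1 : Matrix _ _ ℝ) - flipMatrix n k =
        Matrix.scalar _ z - flipMatrix n k := by
      rw [Matrix.scalar_apply, ← Matrix.smul_one_eq_diagonal]
    rw [h2, ← Matrix.eval_charpoly, hT.charpoly_eq, Polynomial.eval_prod,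
      ← Finset.prod_filter_mul_prod_filter_not _ (fun i => hT.eigenvalues i = 1),
      ← Finset.prod_const, ← Finset.prod_const]
    congr 1
    · refine Finset.prod_congr rfl fun i hi => ?_
      have : hT.eigenvalues i = 1 := by simpa using hi
      simp [this]
    · refine Finset.prod_congr rfl fun i hi => ?_
      have : hT.eigenvalues i = -1 := (hsq i).resolve_left (by simpa using hi)
      simp [this]

theorem det_smul_one_add_lapMatrix_succ {a b : ℕ}
    (hab : ∀ z : ℝ, (z • (1 : Matrix _ _ ℝ) - flipMatrix n k).det = (z - 1) ^ a * (z + 1) ^ b)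
    {w : ℝ} (hw : 0 < w) :
    (w • (1 : Matrix _ _ ℝ) + (sierpinskiGraph (n + 1) k).lapMatrix ℝ).det *
        ((w + k) * (w + k + 2)) ^ k ^ n =
      (w + k) ^ a * (w + k + 2) ^ b *
        ((w * (w + k + 2)) • (1 : Matrix _ _ ℝ) + (sierpinskiGraph n k).lapMatrix ℝ).det := by
  have hk : (0 : ℝ) ≤ k := k.cast_nonneg
  set z : ℝ := w + k + 1 with hz
  have hz0 : z ^ 2 - 1 ≠ 0 := by
    have : z ^ 2 - 1 = (w + k) * (w + k + 2) := by rw [hz]; ring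
    rw [this]
    positivity
  set T := flipMatrix n k with hT
  set B := blockMatrix n k with hB
  set L := (sierpinskiGraph n k).lapMatrix ℝ with hL
  -- Since `T² = 1`, this is the inverse of `z - T`.
  set D' : Matrix _ _ ℝ := (z ^ 2 - 1)⁻¹ • (z • (1 : Matrix _ _ ℝ) + T) with hD'
  have hDD' : (z • (1 : Matrix _ _ ℝ) - T) * D' = 1 := by
    have hTT : T * T = 1 := flipMatrix_mul_self n k
    have h1 : (z • (1 : Matrix _ _ ℝ) - T) * (z • (1 : Matrix _ _ ℝ) + T) =
        (z ^ 2 - 1) • (1 : Matrix _ _ ℝ) := by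
      simp only [Matrix.sub_mul, Matrix.mul_add, Matrix.smul_mul, Matrix.mul_smul, Matrix.one_mul,
        Matrix.mul_one, hTT]
      module
    rw [hD', Matrix.mul_smul, h1, smul_smul, inv_mul_cancel₀ hz0, one_smul]
  have h1 : w • (1 : Matrix _ _ ℝ) + (sierpinskiGraph (n + 1) k).lapMatrix ℝ =
      (z • (1 : Matrix _ _ ℝ) - T) * (1 - D' * Bᵀ * B) := by
    rw [lapMatrix_sierpinskiGraph_succ, Matrix.mul_sub, Matrix.mul_one, Matrix.mul_assoc D',
      ← Matrix.mul_assoc _ D', hDD', Matrix.one_mul, hz]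
    module
  have h2 : (1 : Matrix _ _ ℝ) - B * (D' * Bᵀ) =
      (z ^ 2 - 1)⁻¹ • ((w * (w + k + 2)) • (1 : Matrix _ _ ℝ) + L) := by
    have h3 : B * (D' * Bᵀ) = (z ^ 2 - 1)⁻¹ •
        (z • (k : ℝ) • (1 : Matrix _ _ ℝ) + ((k : ℝ) • (1 : Matrix _ _ ℝ) - L)) := by
      rw [← blockMatrix_mul_flipMatrix_mul n k, ← blockMatrix_mul_transpose n k]
      simp only [hD', Matrix.smul_mul, Matrix.mul_smul, Matrix.add_mul, Matrix.mul_add,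
        Matrix.one_mul, Matrix.mul_assoc, ← hB, ← hT]
    have h4 : (1 : Matrix (Fin n → Fin k) (Fin n → Fin k) ℝ) =
        (z ^ 2 - 1)⁻¹ • (z ^ 2 - 1) • (1 : Matrix _ _ ℝ) := by
      rw [smul_smul, inv_mul_cancel₀ hz0, one_smul]
    rw [h3]
    nth_rewrite 1 [h4]
    rw [← smul_sub, hz]
    congr 1
    module
  -- Sylvester's identity passes from matrices indexed by half-edges to matrices indexed by
  -- vertices.
  rw [h1, Matrix.det_mul, Matrix.det_one_sub_mul_comm, h2, Matrix.det_smul, hab]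
  have h5 : (w + k) * (w + k + 2) = z ^ 2 - 1 := by rw [hz]; ring
  have h6 : ((z ^ 2 - 1)⁻¹) ^ Fintype.card (Fin n → Fin k) * (z ^ 2 - 1) ^ k ^ n = 1 := by
    rw [Fintype.card_fun, Fintype.card_fin, Fintype.card_fin, ← mul_pow, inv_mul_cancel₀ hz0,
      one_pow]
  rw [h5, show z - 1 = w + k by rw [hz]; ring, show z + 1 = w + k + 2 by rw [hz]; ring]
  linear_combination (w + k) ^ a * (w + k + 2) ^ b *
    ((w * (w + k + 2)) • (1 : Matrix _ _ ℝ) + L).det * h6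

end matrices

/-! ### Logarithmic derivatives of polynomials at zero. -/

namespace Polynomial

/-- The value at `0` of the logarithmic derivative of `p`. -/
noncomputable def logDerivZero (p : ℝ[X]) : ℝ := p.derivative.eval 0 / p.eval 0

/-- The value at `0` of the derivative of the logarithmic derivative of `p`. -/
noncomputable def logDerivDerivZero (p : ℝ[X]) : ℝ :=
  p.derivative.derivative.eval 0 / p.eval 0 - (p.derivative.eval 0 / p.eval 0) ^ 2

theorem logDerivZero_mul {p q : ℝ[X]} (hp : p.eval 0 ≠ 0) (hq : q.eval 0 ≠ 0) :
    logDerivZero (p * q) = logDerivZero p + logDerivZero q := by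
  simp only [logDerivZero, derivative_mul, eval_add, eval_mul]
  field_simp

theorem logDerivDerivZero_mul {p q : ℝ[X]} (hp : p.eval 0 ≠ 0) (hq : q.eval 0 ≠ 0) :
    logDerivDerivZero (p * q) = logDerivDerivZero p + logDerivDerivZero q := by
  simp only [logDerivDerivZero, derivative_mul, derivative_add, eval_add, eval_mul]
  field_simp
  ring

theorem logDerivZero_prod {ι : Type*} (s : Finset ι) (p : ι → ℝ[X])
    (hp : ∀ i ∈ s, (p i).eval 0 ≠ 0) :
    logDerivZero (∏ i ∈ s, p i) = ∑ i ∈ s, logDerivZero (p i) := by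
  classical
  induction s using Finset.induction_on with
  | empty => simp [logDerivZero]
  | insert i s hi ih =>
    rw [Finset.prod_insert hi, Finset.sum_insert hi, logDerivZero_mul (hp i (by simp)),
      ih fun j hj => hp j (by simp [hj])]
    rw [eval_prod]
    exact Finset.prod_ne_zero_iff.2 fun j hj => hp j (by simp [hj])

theorem logDerivDerivZero_prod {ι : Type*} (s : Finset ι) (p : ι → ℝ[X])
    (hp : ∀ i ∈ s, (p i).eval 0 ≠ 0) :
    logDerivDerivZero (∏ i ∈ s, p i) = ∑ i ∈ s, logDerivDerivZero (p i) := by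
  classical
  induction s using Finset.induction_on with
  | empty => simp [logDerivDerivZero]
  | insert i s hi ih =>
    rw [Finset.prod_insert hi, Finset.sum_insert hi, logDerivDerivZero_mul (hp i (by simp)),
      ih fun j hj => hp j (by simp [hj])]
    rw [eval_prod]
    exact Finset.prod_ne_zero_iff.2 fun j hj => hp j (by simp [hj])

theorem logDerivZero_pow {p : ℝ[X]} (hp : p.eval 0 ≠ 0) (m : ℕ) :
    logDerivZero (p ^ m) = m * logDerivZero p := by
  rw [← Finset.card_range m, ← Finset.prod_const, logDerivZero_prod _ _ fun _ _ => hp]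
  simp

theorem logDerivDerivZero_pow {p : ℝ[X]} (hp : p.eval 0 ≠ 0) (m : ℕ) :
    logDerivDerivZero (p ^ m) = m * logDerivDerivZero p := by
  rw [← Finset.card_range m, ← Finset.prod_const, logDerivDerivZero_prod _ _ fun _ _ => hp]
  simp

theorem logDerivZero_X_add_C (c : ℝ) : logDerivZero (X + C c) = 1 / c := by
  simp [logDerivZero]

theorem logDerivDerivZero_X_add_C (c : ℝ) : logDerivDerivZero (X + C c) = -(1 / c ^ 2) := by
  simp [logDerivDerivZero]

theorem logDerivZero_quadratic (b c : ℝ) : logDerivZero (X * (X + C b) + C c) = b / c := by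
  simp [logDerivZero]

theorem logDerivDerivZero_quadratic (b c : ℝ) :
    logDerivDerivZero (X * (X + C b) + C c) = 2 / c - (b / c) ^ 2 := by
  simp [logDerivDerivZero, one_add_one_eq_two]

/-- The products in `h` become sums under both operations. A factor `X + f i` contributes power sums
of `1 / f i`; a factor `X (X + d) + g i` mixes first and second powers of `1 / g i`. -/
theorem logDeriv_identities {ι κ : Type*} {s : Finset ι} {t : Finset κ} {f : ι → ℝ} {g : κ → ℝ}
    {c d : ℝ} (hc : c ≠ 0) (hd : d ≠ 0) (hf : ∀ i ∈ s, f i ≠ 0) (hg : ∀ i ∈ t, g i ≠ 0)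
    {N a b : ℕ}
    (h : (∏ i ∈ s, (X + C (f i))) * ((X + C c) ^ N * (X + C d) ^ N) =
      (X + C c) ^ a * (X + C d) ^ b * ∏ i ∈ t, (X * (X + C d) + C (g i))) :
    ∑ i ∈ s, 1 / f i + (N * (1 / c) + N * (1 / d)) =
      a * (1 / c) + b * (1 / d) + ∑ i ∈ t, d / g i ∧
    ∑ i ∈ s, -(1 / f i ^ 2) + (N * -(1 / c ^ 2) + N * -(1 / d ^ 2)) =
      a * -(1 / c ^ 2) + b * -(1 / d ^ 2) + ∑ i ∈ t, (2 / g i - (d / g i) ^ 2) := by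
  have ec : (X + C c).eval 0 ≠ 0 := by simpa using hc
  have ed : (X + C d).eval 0 ≠ 0 := by simpa using hd
  have ef : ∀ i ∈ s, (X + C (f i)).eval 0 ≠ 0 := fun i hi => by simpa using hf i hi
  have eg : ∀ i ∈ t, (X * (X + C d) + C (g i)).eval 0 ≠ 0 := fun i hi => by simpa using hg i hi
  have pc : ∀ m : ℕ, ((X + C c) ^ m).eval 0 ≠ 0 := fun m => by
    rw [eval_pow]; exact pow_ne_zero _ ec
  have pd : ∀ m : ℕ, ((X + C d) ^ m).eval 0 ≠ 0 := fun m => by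
    rw [eval_pow]; exact pow_ne_zero _ ed
  have pf : (∏ i ∈ s, (X + C (f i))).eval 0 ≠ 0 := by
    rw [eval_prod]; exact Finset.prod_ne_zero_iff.2 ef
  have pg : (∏ i ∈ t, (X * (X + C d) + C (g i))).eval 0 ≠ 0 := by
    rw [eval_prod]; exact Finset.prod_ne_zero_iff.2 eg
  have pcd : ∀ m l : ℕ, ((X + C c) ^ m * (X + C d) ^ l).eval 0 ≠ 0 := fun m l => by
    rw [eval_mul]; exact mul_ne_zero (pc m) (pd l)
  constructor
  · have := congrArg logDerivZero h
    rwa [logDerivZero_mul pf (pcd _ _), logDerivZero_mul (pc _) (pd _),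
      logDerivZero_mul (pcd _ _) pg, logDerivZero_mul (pc _) (pd _), logDerivZero_prod _ _ ef,
      logDerivZero_prod _ _ eg, logDerivZero_pow ec, logDerivZero_pow ed, logDerivZero_pow ec,
      logDerivZero_pow ed, Finset.sum_congr rfl fun i _ => logDerivZero_X_add_C (f i),
      Finset.sum_congr rfl fun i _ => logDerivZero_quadratic d (g i), logDerivZero_X_add_C,
      logDerivZero_X_add_C] at this
  · have := congrArg logDerivDerivZero h
    rwa [logDerivDerivZero_mul pf (pcd _ _), logDerivDerivZero_mul (pc _) (pd _),
      logDerivDerivZero_mul (pcd _ _) pg, logDerivDerivZero_mul (pc _) (pd _),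
      logDerivDerivZero_prod _ _ ef, logDerivDerivZero_prod _ _ eg, logDerivDerivZero_pow ec,
      logDerivDerivZero_pow ed, logDerivDerivZero_pow ec, logDerivDerivZero_pow ed,
      Finset.sum_congr rfl fun i _ => logDerivDerivZero_X_add_C (f i),
      Finset.sum_congr rfl fun i _ => logDerivDerivZero_quadratic d (g i),
      logDerivDerivZero_X_add_C, logDerivDerivZero_X_add_C] at this

end Polynomial

/-! ### The kernel of the Laplacian of a connected graph. -/

section kernel
open Matrix

variable {V : Type*} [Fintype V] [DecidableEq V] (G : SimpleGraph V) [DecidableRel G.Adj]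

theorem eigenvectorBasis_apply_eq_of_eigenvalue_eq_zero
    (hG : ∀ f : V → ℝ, (∀ i j, G.Adj i j → f i = f j) → ∀ i j, f i = f j) {l : V}
    (hl : (G.isHermitian_lapMatrix ℝ).eigenvalues l = 0) (i j : V) :
    (G.isHermitian_lapMatrix ℝ).eigenvectorBasis l i =
      (G.isHermitian_lapMatrix ℝ).eigenvectorBasis l j := by
  have h := (G.isHermitian_lapMatrix ℝ).mulVec_eigenvectorBasis l
  rw [hl, zero_smul] at h
  exact hG _ ((G.lapMatrix_mulVec_eq_zero_iff_forall_adj).1 h) i j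

/-- The Laplacian matrix of a connected graph has exactly one zero eigenvalue. -/
theorem exists_eigenvalues_lapMatrix_eq_zero_iff [Nonempty V]
    (hG : ∀ f : V → ℝ, (∀ i j, G.Adj i j → f i = f j) → ∀ i j, f i = f j) :
    ∃ l₀, ∀ l, (G.isHermitian_lapMatrix ℝ).eigenvalues l = 0 ↔ l = l₀ := by
  set hL := G.isHermitian_lapMatrix ℝ
  have hdet := hL.det_eq_prod_eigenvalues
  rw [G.det_lapMatrix_eq_zero, eq_comm, Finset.prod_eq_zero_iff] at hdet
  obtain ⟨l₀, -, h0⟩ := hdet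
  replace h0 : hL.eigenvalues l₀ = 0 := by simpa using h0
  refine ⟨l₀, fun l => ⟨fun hl => ?_, fun hl => hl ▸ h0⟩⟩
  by_contra hne
  -- Both eigenvectors would be constant; orthogonality then forces one of them to vanish,
  -- contradicting its unit norm.
  have horth := hL.eigenvectorBasis.orthonormal.2 hne
  have hself : ∀ m, inner ℝ (hL.eigenvectorBasis m) (hL.eigenvectorBasis m) = 1 := fun m =>
    hL.eigenvectorBasis.inner_eq_one m
  have i₀ : V := Classical.arbitrary V
  have hc : ∀ i, hL.eigenvectorBasis l i = hL.eigenvectorBasis l i₀ := fun i =>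
    eigenvectorBasis_apply_eq_of_eigenvalue_eq_zero G hG hl i i₀
  have hc0 : ∀ i, hL.eigenvectorBasis l₀ i = hL.eigenvectorBasis l₀ i₀ := fun i =>
    eigenvectorBasis_apply_eq_of_eigenvalue_eq_zero G hG h0 i i₀
  have h1 := hself l
  have h2 := hself l₀
  simp only [PiLp.inner_apply, hc, hc0] at horth h1 h2
  simp at horth h1 h2
  rcases horth with h | h <;> simp [h] at h1 h2

end kernel

/-! ### Recursions for the inverse eigenvalue sums and the closed form. -/

section recursion
open Matrix

/-- The sum of the reciprocals of the nonzero Laplacian eigenvalues of `S(n,k)`. -/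
noncomputable def invEigenvalueSum (n k : ℕ) : ℝ :=
  ∑ i ∈ Finset.univ.filter
      (fun i => ((sierpinskiGraph n k).isHermitian_lapMatrix ℝ).eigenvalues i ≠ 0),
    1 / ((sierpinskiGraph n k).isHermitian_lapMatrix ℝ).eigenvalues i

/-- The sum of the squared reciprocals of the nonzero Laplacian eigenvalues of `S(n,k)`. -/
noncomputable def invSqEigenvalueSum (n k : ℕ) : ℝ :=
  ∑ i ∈ Finset.univ.filter
      (fun i => ((sierpinskiGraph n k).isHermitian_lapMatrix ℝ).eigenvalues i ≠ 0),
    1 / ((sierpinskiGraph n k).isHermitian_lapMatrix ℝ).eigenvalues i ^ 2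

variable (n k : ℕ)

open Polynomial in
theorem exists_prod_X_add_eigenvalues_eq (hk : 0 < k) : ∃ a b : ℕ, a + b = k ^ (n + 1) ∧ (a : ℝ) - b = k ∧
    (∏ i ∈ Finset.univ.filter
      (fun i => ((sierpinskiGraph (n + 1) k).isHermitian_lapMatrix ℝ).eigenvalues i ≠ 0),
      (X + C (((sierpinskiGraph (n + 1) k).isHermitian_lapMatrix ℝ).eigenvalues i))) *
      ((X + C (k : ℝ)) ^ k ^ n * (X + C ((k : ℝ) + 2)) ^ k ^ n) =
    (X + C (k : ℝ)) ^ a * (X + C ((k : ℝ) + 2)) ^ (b + 1) *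
      ∏ i ∈ Finset.univ.filter
        (fun i => ((sierpinskiGraph n k).isHermitian_lapMatrix ℝ).eigenvalues i ≠ 0),
        (X * (X + C ((k : ℝ) + 2)) +
          C (((sierpinskiGraph n k).isHermitian_lapMatrix ℝ).eigenvalues i)) := by
  obtain ⟨a, b, h1, h2, hab⟩ := exists_det_smul_one_sub_flipMatrix n k
  -- Both sides are polynomials in `w`, so agreement on the positive reals suffices.
  refine ⟨a, b, h1, h2, eq_of_infinite_eval_eq _ _
    ((Set.Ioi_infinite (0 : ℝ)).mono fun w (hw : 0 < w) => ?_)⟩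
  have : Nonempty (Fin k) := ⟨⟨0, hk⟩⟩
  have h := det_smul_one_add_lapMatrix_succ n k hab hw
  -- The single zero eigenvalue yields the factor `z`. On the right `z = w (w + k + 2)`: its factor
  -- `w` cancels against the left side, and `w + k + 2` raises the exponent `b` to `b + 1`.
  have key : ∀ m (z : ℝ), (z • (1 : Matrix _ _ ℝ) + (sierpinskiGraph m k).lapMatrix ℝ).det =
      z * ∏ i ∈ Finset.univ.filter
        (fun i => ((sierpinskiGraph m k).isHermitian_lapMatrix ℝ).eigenvalues i ≠ 0),
        (z + ((sierpinskiGraph m k).isHermitian_lapMatrix ℝ).eigenvalues i) := by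
    intro m z
    rw [((sierpinskiGraph m k).isHermitian_lapMatrix ℝ).det_smul_one_add]
    obtain ⟨l₀, hl⟩ := exists_eigenvalues_lapMatrix_eq_zero_iff (sierpinskiGraph m k)
      (fun f hf => eq_of_forall_sierpinskiGraph_adj m f hf)
    rw [← Finset.prod_filter_mul_prod_filter_not _
      (fun i => ((sierpinskiGraph m k).isHermitian_lapMatrix ℝ).eigenvalues i = 0)]
    congr 1
    have hs : (Finset.univ.filter fun i =>
        ((sierpinskiGraph m k).isHermitian_lapMatrix ℝ).eigenvalues i = 0) = {l₀} := by
      ext i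
      simp [hl]
    rw [hs, Finset.prod_singleton, (hl l₀).2 rfl, add_zero]
  rw [key, key] at h
  simp only [Set.mem_ofPred_eq, eval_mul, eval_prod, eval_add, eval_X, eval_C, eval_pow,
    ← add_assoc]
  refine mul_left_cancel₀ hw.ne' ?_
  rw [mul_pow] at h
  linear_combination h

theorem inverse_eigenvalue_sum_recursion (hk : 0 < k) : ∃ a b : ℝ,
    a + b = k ^ (n + 1) ∧ a - b = k ∧
    invEigenvalueSum (n + 1) k + k ^ n * (1 / k + 1 / (k + 2)) =
      a / k + (b + 1) / (k + 2) + (k + 2) * invEigenvalueSum n k ∧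
    invSqEigenvalueSum (n + 1) k + k ^ n * (1 / k ^ 2 + 1 / (k + 2) ^ 2) =
      a / k ^ 2 + (b + 1) / (k + 2) ^ 2 + (k + 2) ^ 2 * invSqEigenvalueSum n k
        - 2 * invEigenvalueSum n k := by
  obtain ⟨a, b, h1, h2, h⟩ := exists_prod_X_add_eigenvalues_eq n k hk
  have hk' : (0 : ℝ) < k := Nat.cast_pos.2 hk
  obtain ⟨h3, h4⟩ := Polynomial.logDeriv_identities hk'.ne' (by positivity)
    (fun i hi => by simpa using hi) (fun i hi => by simpa using hi) h
  refine ⟨a, b, by exact_mod_cast h1, h2, ?_, ?_⟩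
  · have h5 : ((k : ℝ) + 2) * invEigenvalueSum n k = _ := Finset.mul_sum _ _ _
    simp only [mul_one_div] at h5
    rw [h5, invEigenvalueSum]
    push_cast at h3
    linear_combination h3
  · have h5 : ((k : ℝ) + 2) ^ 2 * invSqEigenvalueSum n k = _ := Finset.mul_sum _ _ _
    have h6 : 2 * invEigenvalueSum n k = _ := Finset.mul_sum _ _ _
    simp only [mul_one_div] at h5 h6
    rw [h5, h6, invSqEigenvalueSum]
    push_cast at h4
    simp only [Finset.sum_neg_distrib, Finset.sum_sub_distrib, div_pow] at h4
    linear_combination -h4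

theorem invEigenvalueSum_eq (hk : 0 < k) : invEigenvalueSum n k =
    ((k - 2) * (k + 1) / (2 * k * (k + 2)) + 2 / ((k + 1) * (k + 2))) * (k + 2) ^ n
      - (k - 2) * (k + 1) / (2 * k * (k + 2)) * k ^ n - 2 / ((k + 1) * (k + 2)) := by
  have hk' : (0 : ℝ) < k := Nat.cast_pos.2 hk
  induction n with
  | zero =>
    have : Nonempty (Fin k) := ⟨⟨0, hk⟩⟩
    obtain ⟨l₀, hl⟩ := exists_eigenvalues_lapMatrix_eq_zero_iff (sierpinskiGraph 0 k)
      (fun f hf => eq_of_forall_sierpinskiGraph_adj 0 f hf)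
    have hz : ∀ i, ((sierpinskiGraph 0 k).isHermitian_lapMatrix ℝ).eigenvalues i = 0 := fun i =>
      (hl i).2 (Subsingleton.elim _ _)
    simp [invEigenvalueSum, hz]
  | succ n ih =>
    obtain ⟨a, b, h1, h2, h3, -⟩ := inverse_eigenvalue_sum_recursion n k hk
    have ha : a = (k ^ (n + 1) + k) / 2 := by linarith
    have hb : b = (k ^ (n + 1) - k) / 2 := by linarith
    rw [ih, ha, hb] at h3
    rw [eq_sub_of_add_eq h3]
    field_simp
    ring

/-- The explicit value of the second-order coherence of `S(n,k)`. -/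
theorem secondOrderCoherence_sierpinskiGraph (hk : 0 < k) :
    secondOrderCoherence (sierpinskiGraph n k) = sierpinskiClosedForm n k := by
  have hk' : (0 : ℝ) < k := Nat.cast_pos.2 hk
  have hS : secondOrderCoherence (sierpinskiGraph n k) =
      1 / (2 * (k : ℝ) ^ n) * invSqEigenvalueSum n k := by
    simp [secondOrderCoherence, invSqEigenvalueSum]
  have hz : ∀ m : ℕ, ((k : ℝ) + 2) ^ ((m : ℤ) - 2) = (k + 2) ^ m / (k + 2) ^ 2 := by
    intro m
    rw [zpow_sub₀ (by positivity)]
    norm_cast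
  have hz2 : ∀ m : ℕ, ((k : ℝ) + 2) ^ (2 * (m : ℤ) - 2) = ((k + 2) ^ m) ^ 2 / (k + 2) ^ 2 := by
    intro m
    rw [zpow_sub₀ (by positivity), ← pow_mul, mul_comm m]
    norm_cast
  have hmain : invSqEigenvalueSum n k = 2 * (k : ℝ) ^ n * sierpinskiClosedForm n k := by
    induction n with
    -- The closed form vanishes at `n = 0`, as does the empty eigenvalue sum, so the induction can
    -- start at the one-vertex graph.
    | zero =>
      have : Nonempty (Fin k) := ⟨⟨0, hk⟩⟩
      obtain ⟨l₀, hl⟩ := exists_eigenvalues_lapMatrix_eq_zero_iff (sierpinskiGraph 0 k)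
        (fun f hf => eq_of_forall_sierpinskiGraph_adj 0 f hf)
      have hz' : ∀ i, ((sierpinskiGraph 0 k).isHermitian_lapMatrix ℝ).eigenvalues i = 0 := fun i =>
        (hl i).2 (Subsingleton.elim _ _)
      have h0 : invSqEigenvalueSum 0 k = 0 := by simp [invSqEigenvalueSum, hz']
      rw [h0, sierpinskiClosedForm, hz, hz2]
      field_simp
      ring
    | succ n ih =>
      obtain ⟨a, b, h1, h2, -, h3⟩ := inverse_eigenvalue_sum_recursion n k hk
      have ha : a = (k ^ (n + 1) + k) / 2 := by linarith
      have hb : b = (k ^ (n + 1) - k) / 2 := by linarith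
      rw [ih (by simp [secondOrderCoherence, invSqEigenvalueSum]), invEigenvalueSum_eq n k hk,
        ha, hb] at h3
      rw [eq_sub_of_add_eq h3, sierpinskiClosedForm, sierpinskiClosedForm, hz, hz2, hz, hz2]
      have hu : (k : ℝ) ^ n ≠ 0 := by positivity
      simp only [pow_succ]
      generalize (k : ℝ) ^ n = u at hu ⊢
      generalize ((k : ℝ) + 2) ^ n = v
      field_simp
      ring
  rw [hS, hmain]
  field_simp

end recursion

/-! ### Asymptotics for large `n`. -/

theorem rpow_two_mul_log_div_log_sub_one {k : ℕ} (hk : 3 ≤ k) (n : ℕ) :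
    (Fintype.card (Fin n → Fin k) : ℝ) ^ (2 * Real.log (k + 2) / Real.log k - 1) =
      (((k : ℝ) + 2) ^ n) ^ 2 / (k : ℝ) ^ n := by
  have hk0 : (0 : ℝ) < k := Nat.cast_pos.2 (by omega)
  have hk1 : (1 : ℝ) < k := by exact_mod_cast (by omega : 1 < k)
  have hlog : Real.log k ≠ 0 := (Real.log_pos hk1).ne'
  have hN : (Fintype.card (Fin n → Fin k) : ℝ) = (k : ℝ) ^ n := by simp
  rw [hN, Real.rpow_def_of_pos (by positivity), Real.log_pow,
    show (n : ℝ) * Real.log k * (2 * Real.log (k + 2) / Real.log k - 1) =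
      Real.log ((((k : ℝ) + 2) ^ n) ^ 2 / (k : ℝ) ^ n) from ?_, Real.exp_log (by positivity)]
  rw [Real.log_div (by positivity) (by positivity), Real.log_pow, Real.log_pow, Real.log_pow]
  field_simp
  push_cast
  ring

/-- Divided by its leading term, the closed form is `1` plus multiples of geometric sequences with
ratios `1/(k+2)²`, `k/(k+2)²` and `1/(k+2)`, all less than `1`. -/
theorem secondOrderCoherence_isEquivalent {k : ℕ} (hk : 3 ≤ k) :
    (fun n : ℕ => secondOrderCoherence (sierpinskiGraph n k)) ~[atTop]
      (fun n : ℕ => sierpinskiLeadingCoeff k *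
        (Fintype.card (Fin n → Fin k) : ℝ) ^ (2 * Real.log (k + 2) / Real.log k - 1)) := by
  have hk0 : (0 : ℝ) < k := Nat.cast_pos.2 (by omega)
  have hk1 : (0 : ℝ) < k - 1 := by
    have : (1 : ℝ) < k := by exact_mod_cast (by omega : 1 < k)
    linarith
  have hh : 0 < sierpinskiLeadingCoeff k := by
    rw [sierpinskiLeadingCoeff]
    positivity
  set c₁ : ℝ := (7 * k ^ 2 + 13 * k + 2) / (2 * k * (k + 1) ^ 2 * (k + 2) ^ 2 * (k + 3))
  set c₂ : ℝ := ((k - 2) * (k ^ 3 + 4 * k ^ 2 + 4 * k + 2)) /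
    (2 * k ^ 2 * (k + 2) ^ 2 * (k ^ 2 + 3 * k + 4))
  set c₃ : ℝ := (k - 1) * (k ^ 2 + k + 2) / (2 * k * (k + 1) ^ 2 * (k + 2) ^ 2)
  set h : ℝ := sierpinskiLeadingCoeff k with hdef
  have hz : ∀ m : ℕ, ((k : ℝ) + 2) ^ ((m : ℤ) - 2) = (k + 2) ^ m / (k + 2) ^ 2 := by
    intro m
    rw [zpow_sub₀ (by positivity)]
    norm_cast
  have hz2 : ∀ m : ℕ, ((k : ℝ) + 2) ^ (2 * (m : ℤ) - 2) = ((k + 2) ^ m) ^ 2 / (k + 2) ^ 2 := by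
    intro m
    rw [zpow_sub₀ (by positivity), ← pow_mul, mul_comm m]
    norm_cast
  have hratio : ∀ n : ℕ, (secondOrderCoherence (sierpinskiGraph n k)) /
      (h * (Fintype.card (Fin n → Fin k) : ℝ) ^ (2 * Real.log (k + 2) / Real.log k - 1)) =
      1 - c₁ / h * ((1 / ((k : ℝ) + 2)) ^ n) ^ 2 - c₂ / h * (k / ((k : ℝ) + 2) ^ 2) ^ n
        + c₃ / h * (1 / ((k : ℝ) + 2)) ^ n := by
    intro n
    have h4 : sierpinskiClosedForm n k = (-c₁ - c₂ * (k : ℝ) ^ n + c₃ * ((k : ℝ) + 2) ^ n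
        + h * (((k : ℝ) + 2) ^ n) ^ 2) / (k : ℝ) ^ n := by
      rw [sierpinskiClosedForm, hz, hz2, hdef, sierpinskiLeadingCoeff]
      simp only [c₁, c₂, c₃, pow_succ _ n, pow_add _ n]
      have hu : (k : ℝ) ^ n ≠ 0 := by positivity
      generalize (k : ℝ) ^ n = u at hu ⊢
      generalize ((k : ℝ) + 2) ^ n = v
      field_simp
    rw [secondOrderCoherence_sierpinskiGraph n k (by omega), rpow_two_mul_log_div_log_sub_one hk,
      h4, div_pow, div_pow, div_pow, one_pow, pow_right_comm _ 2 n]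
    have hu : (k : ℝ) ^ n ≠ 0 := by positivity
    have hv : ((k : ℝ) + 2) ^ n ≠ 0 := by positivity
    field_simp
    ring
  refine (isEquivalent_iff_tendsto_one (Eventually.of_forall fun n => ?_)).2 ?_
  · rw [rpow_two_mul_log_div_log_sub_one hk]
    positivity
  · have hfun : ((fun n : ℕ => secondOrderCoherence (sierpinskiGraph n k)) /
        (fun n : ℕ => h * (Fintype.card (Fin n → Fin k) : ℝ) ^
          (2 * Real.log (k + 2) / Real.log k - 1))) = _ := funext hratio
    rw [hfun]
    have t1 : Tendsto (fun n : ℕ => (1 / ((k : ℝ) + 2)) ^ n) atTop (𝓝 0) :=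
      tendsto_pow_atTop_nhds_zero_of_lt_one (by positivity)
        (by rw [div_lt_one (by positivity)]; linarith)
    have t2 : Tendsto (fun n : ℕ => (k / ((k : ℝ) + 2) ^ 2) ^ n) atTop (𝓝 0) :=
      tendsto_pow_atTop_nhds_zero_of_lt_one (by positivity)
        (by rw [div_lt_one (by positivity)]; nlinarith)
    have t3 : Tendsto (fun n : ℕ => 1 - c₁ / h * ((1 / ((k : ℝ) + 2)) ^ n) ^ 2
        - c₂ / h * (k / ((k : ℝ) + 2) ^ 2) ^ n + c₃ / h * (1 / ((k : ℝ) + 2)) ^ n) atTop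
        (𝓝 (1 - c₁ / h * 0 ^ 2 - c₂ / h * 0 + c₃ / h * 0)) :=
      ((tendsto_const_nhds.sub ((t1.pow 2).const_mul (c₁ / h))).sub
        (t2.const_mul (c₂ / h))).add (t1.const_mul (c₃ / h))
    rwa [show 1 - c₁ / h * 0 ^ 2 - c₂ / h * 0 + c₃ / h * 0 = 1 by ring] at t3

/-! ### The deterministic damped oscillator. -/

/-- `K` with derivative `M` is the impulse response of the damped oscillator
`y'' = -l y - l y'`. -/
structure IsImpulseResponse (l : ℝ) (K M : ℝ → ℝ) : Prop where
  hasDerivAt_K : ∀ t, HasDerivAt K (M t) t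
  hasDerivAt_M : ∀ t, HasDerivAt M (-l * K t - l * M t) t
  K_zero : K 0 = 0
  M_zero : M 0 = 1

/-- The exponential of the first-order system, applied to the initial vector `(0, 1)`, avoids
distinguishing real, double and complex characteristic roots. -/
theorem exists_isImpulseResponse (l : ℝ) : ∃ K M, IsImpulseResponse l K M := by
  let A : ℝ × ℝ →L[ℝ] ℝ × ℝ := (ContinuousLinearMap.snd ℝ ℝ ℝ).prod
    (-l • ContinuousLinearMap.fst ℝ ℝ ℝ - l • ContinuousLinearMap.snd ℝ ℝ ℝ)
  let Φ : ℝ → ℝ × ℝ := fun t => NormedSpace.exp (t • A) (0, 1)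
  have hΦ : ∀ t, HasDerivAt Φ (A (Φ t)) t := fun t =>
    ((ContinuousLinearMap.apply ℝ (ℝ × ℝ) ((0, 1) : ℝ × ℝ)).hasFDerivAt.comp_hasDerivAt t
      (hasDerivAt_exp_smul_const' A t))
  refine ⟨fun t => (Φ t).1, fun t => (Φ t).2, fun t => ?_, fun t => ?_, ?_, ?_⟩
  · exact (hasFDerivAt_fst.comp_hasDerivAt t (hΦ t))
  · exact (hasFDerivAt_snd.comp_hasDerivAt t (hΦ t)).congr_deriv (by simp [A])
  · simp [Φ]
  · simp [Φ]

namespace IsImpulseResponse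

variable {l : ℝ} {K M : ℝ → ℝ} (h : IsImpulseResponse l K M)
include h

theorem continuous_K : Continuous K :=
  continuous_iff_continuousAt.2 fun t => (h.hasDerivAt_K t).continuousAt

theorem continuous_M : Continuous M :=
  continuous_iff_continuousAt.2 fun t => (h.hasDerivAt_M t).continuousAt

/-- The quadratic form is a Lyapunov function: its derivative is `-(K² + M²)`, and it is at most `S
(K² + M²)`, so it decays at least like `exp (-t / S)`. -/
theorem tendsto_sq_add_sq (hl : 0 < l) :
    Tendsto (fun t => (K t + M t) ^ 2 / (2 * l) + K t ^ 2 + M t ^ 2 / (2 * l ^ 2)) atTop (𝓝 0) := by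
  set Q : ℝ → ℝ := fun t => (K t + M t) ^ 2 / (2 * l) + K t ^ 2 + M t ^ 2 / (2 * l ^ 2) with hQ
  have hdQ : ∀ t, HasDerivAt Q (-(K t ^ 2 + M t ^ 2)) t := by
    intro t
    have h1 := h.hasDerivAt_K t
    have h2 := h.hasDerivAt_M t
    have := ((((h1.add h2).pow 2).div_const (2 * l)).add (h1.pow 2)).add
      ((h2.pow 2).div_const (2 * l ^ 2))
    refine this.congr_deriv ?_
    simp only [Pi.add_apply]
    field_simp
    ring
  set S : ℝ := 1 / l + 1 + 1 / (2 * l ^ 2) with hS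
  have hSpos : 0 < S := by positivity
  have hle : ∀ t, Q t ≤ S * (K t ^ 2 + M t ^ 2) := by
    intro t
    have e : S * (K t ^ 2 + M t ^ 2) - Q t =
        (K t - M t) ^ 2 / (2 * l) + M t ^ 2 + K t ^ 2 / (2 * l ^ 2) := by
      simp only [hS, hQ]
      field_simp
      ring
    have : 0 ≤ (K t - M t) ^ 2 / (2 * l) + M t ^ 2 + K t ^ 2 / (2 * l ^ 2) := by positivity
    linarith
  have hanti : Antitone fun t => Q t * Real.exp (t / S) := by
    refine antitone_of_hasDerivAt_nonpos (f' := fun t => -(K t ^ 2 + M t ^ 2) * Real.exp (t / S) +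
      Q t * (Real.exp (t / S) * (1 / S))) (fun t => ?_) (fun t => ?_)
    · exact (hdQ t).mul (((hasDerivAt_id t).div_const S).exp)
    · have e : -(K t ^ 2 + M t ^ 2) * Real.exp (t / S) + Q t * (Real.exp (t / S) * (1 / S)) =
          -(Real.exp (t / S) * ((S * (K t ^ 2 + M t ^ 2) - Q t) / S)) := by
        field_simp
        ring
      simp only [Pi.zero_apply]
      rw [e, neg_nonpos]
      exact mul_nonneg (Real.exp_pos _).le (div_nonneg (sub_nonneg.2 (hle t)) hSpos.le)
  have hbound : ∀ t, 0 ≤ t → Q t ≤ Q 0 * Real.exp (-(t / S)) := by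
    intro t ht
    have := hanti ht
    simp only [zero_div, Real.exp_zero, mul_one] at this
    rwa [Real.exp_neg, ← div_eq_mul_inv, le_div_iff₀ (Real.exp_pos _)]
  have hexp : Tendsto (fun t => Q 0 * Real.exp (-(t / S))) atTop (𝓝 0) := by
    simpa using ((Real.tendsto_exp_neg_atTop_nhds_zero.comp
      (tendsto_id.atTop_div_const hSpos)).const_mul (Q 0))
  refine tendsto_of_tendsto_of_tendsto_of_le_of_le' tendsto_const_nhds hexp
    (Eventually.of_forall fun t => ?_) ((eventually_ge_atTop 0).mono hbound)
  positivity

theorem tendsto_K (hl : 0 < l) : Tendsto K atTop (𝓝 0) := by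
  have h1 : Tendsto (fun t => K t ^ 2) atTop (𝓝 0) :=
    squeeze_zero (fun t => sq_nonneg _) (fun t => by
      have : 0 ≤ (K t + M t) ^ 2 / (2 * l) + M t ^ 2 / (2 * l ^ 2) := by positivity
      linarith) (h.tendsto_sq_add_sq hl)
  have h2 := h1.sqrt
  simp only [Real.sqrt_sq_eq_abs, Real.sqrt_zero] at h2
  exact (tendsto_zero_iff_abs_tendsto_zero _).2 h2

theorem tendsto_M (hl : 0 < l) : Tendsto M atTop (𝓝 0) := by
  have h1 : Tendsto (fun t => M t ^ 2) atTop (𝓝 0) := by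
    have h0 := (h.tendsto_sq_add_sq hl).const_mul (2 * l ^ 2)
    rw [mul_zero] at h0
    refine squeeze_zero (fun t => sq_nonneg _) (fun t => ?_) h0
    have e : 2 * l ^ 2 * ((K t + M t) ^ 2 / (2 * l) + K t ^ 2 + M t ^ 2 / (2 * l ^ 2)) =
      2 * l ^ 2 * ((K t + M t) ^ 2 / (2 * l) + K t ^ 2) + M t ^ 2 := by field_simp
    have : 0 ≤ 2 * l ^ 2 * ((K t + M t) ^ 2 / (2 * l) + K t ^ 2) := by positivity
    linarith
  have h2 := h1.sqrt
  simp only [Real.sqrt_sq_eq_abs, Real.sqrt_zero] at h2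
  exact (tendsto_zero_iff_abs_tendsto_zero _).2 h2

theorem tendsto_integral_sq (hl : 0 < l) :
    Tendsto (fun t => ∫ s in (0 : ℝ)..t, K s ^ 2) atTop (𝓝 (1 / (2 * l ^ 2))) := by
  -- A primitive of `K²` that is a quadratic form in `K` and `M`. It tends to `0`, and its value at
  -- `0` is `-1/(2l²)`.
  set R : ℝ → ℝ := fun t =>
    -((1 + 1 / l) / 2 * K t ^ 2 + 1 / l * (K t * M t) + 1 / (2 * l ^ 2) * M t ^ 2) with hR
  have hdR : ∀ t, HasDerivAt R (K t ^ 2) t := by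
    intro t
    have h1 := h.hasDerivAt_K t
    have h2 := h.hasDerivAt_M t
    have := ((((h1.pow 2).const_mul ((1 + 1 / l) / 2)).add ((h1.mul h2).const_mul (1 / l))).add
      ((h2.pow 2).const_mul (1 / (2 * l ^ 2)))).neg
    refine this.congr_deriv ?_
    field_simp
    ring
  have hint : ∀ t, ∫ s in (0 : ℝ)..t, K s ^ 2 = R t - R 0 := fun t =>
    intervalIntegral.integral_eq_sub_of_hasDerivAt (fun s _ => hdR s)
      ((h.continuous_K.pow 2).intervalIntegrable _ _)
  simp only [hint]
  have hK := h.tendsto_K hl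
  have hM := h.tendsto_M hl
  have := (((((hK.pow 2).const_mul ((1 + 1 / l) / 2)).add ((hK.mul hM).const_mul (1 / l))).add
      ((hM.pow 2).const_mul (1 / (2 * l ^ 2)))).neg).sub_const (R 0)
  simpa [hR, h.K_zero, h.M_zero] using this

/-- Variation of constants for the oscillator driven by the derivative of `w`. -/
theorem eq_of_integral_eq {a b w : ℝ → ℝ} (ha : Continuous a) (hb : Continuous b)
    (hab : ∀ t, 0 ≤ t → a t = a 0 + ∫ s in (0 : ℝ)..t, b s)
    (hbw : ∀ t, 0 ≤ t → b t = b 0 + (∫ s in (0 : ℝ)..t, (-l * a s - l * b s)) + w t)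
    {t : ℝ} (ht : 0 ≤ t) :
    a t = (M t + l * K t) * a 0 + K t * b 0 + ∫ s in (0 : ℝ)..t, M (t - s) * w s := by
  set a' : ℝ → ℝ := fun t => a 0 + ∫ s in (0 : ℝ)..t, b s with ha'
  -- This is the velocity minus the noise on `t ≥ 0`: it is differentiable although `w` need not be.
  set b' : ℝ → ℝ := fun t => b 0 + ∫ s in (0 : ℝ)..t, (-l * a s - l * b s) with hb'
  have hcab : Continuous fun s => -l * a s - l * b s := by fun_prop
  have hda : ∀ s, HasDerivAt a' (b s) s := fun s =>
    (intervalIntegral.integral_hasDerivAt_right (hb.intervalIntegrable _ _)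
      hb.stronglyMeasurable.stronglyMeasurableAtFilter hb.continuousAt).const_add _
  have hdb : ∀ s, HasDerivAt b' (-l * a s - l * b s) s := fun s =>
    (intervalIntegral.integral_hasDerivAt_right (hcab.intervalIntegrable _ _)
      hcab.stronglyMeasurable.stronglyMeasurableAtFilter hcab.continuousAt).const_add _
  have hsub : ∀ s, HasDerivAt (fun s => t - s) (-1) s := fun s => by
    simpa using (hasDerivAt_id s).const_sub t
  have hdK : ∀ s, HasDerivAt (fun s => K (t - s)) (-M (t - s)) s := fun s => by
    exact ((h.hasDerivAt_K (t - s)).comp s (hsub s)).congr_deriv (by ring)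
  have hdM : ∀ s, HasDerivAt (fun s => M (t - s)) (-(-l * K (t - s) - l * M (t - s))) s :=
    fun s => ((h.hasDerivAt_M (t - s)).comp s (hsub s)).congr_deriv (by ring)
  have hd : ∀ s ∈ Set.uIcc 0 t, HasDerivAt
      (fun s => (M (t - s) + l * K (t - s)) * a' s + K (t - s) * b' s)
      (M (t - s) * (b s - b' s)) s := by
    intro s hs
    rw [Set.uIcc_of_le ht] at hs
    refine ((((hdM s).add ((hdK s).const_mul l)).mul (hda s)).add
      ((hdK s).mul (hdb s))).congr_deriv ?_
    have : a' s = a s := (hab s hs.1).symm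
    simp only [Pi.add_apply, this]
    ring
  have hb'c : Continuous b' := continuous_iff_continuousAt.2 fun s => (hdb s).continuousAt
  have hMc := h.continuous_M
  have hint := intervalIntegral.integral_eq_sub_of_hasDerivAt hd
    (Continuous.intervalIntegrable (by fun_prop) _ _)
  have hcongr : ∫ s in (0 : ℝ)..t, M (t - s) * w s =
      ∫ s in (0 : ℝ)..t, M (t - s) * (b s - b' s) := by
    refine intervalIntegral.integral_congr fun s hs => ?_
    rw [Set.uIcc_of_le ht] at hs
    simp only [hb', hbw s hs.1]
    ring
  rw [hcongr, hint, hab t ht]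
  simp [ha', hb', h.K_zero, h.M_zero]

/-- The variance of the convolution of `M` with a Brownian motion. -/
theorem integral_integral_mul_min {t : ℝ} (ht : 0 ≤ t) :
    ∫ s in (0 : ℝ)..t, M (t - s) * ∫ r in (0 : ℝ)..t, M (t - r) * min s r =
      ∫ s in (0 : ℝ)..t, K s ^ 2 := by
  have hMc := h.continuous_M
  have hKc := h.continuous_K
  have hsub : ∀ s, HasDerivAt (fun s => t - s) (-1) s := fun s => by
    simpa using (hasDerivAt_id s).const_sub t
  have hdK : ∀ s, HasDerivAt (fun s => K (t - s)) (-M (t - s)) s := fun s => by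
    exact ((h.hasDerivAt_K (t - s)).comp s (hsub s)).congr_deriv (by ring)
  set φ : ℝ → ℝ := fun s => ∫ r in (0 : ℝ)..s, K (t - r) with hφ
  have hKtc : Continuous fun s => K (t - s) := by fun_prop
  have hdφ : ∀ s, HasDerivAt φ (K (t - s)) s := fun s =>
    (intervalIntegral.integral_hasDerivAt_right (hKtc.intervalIntegrable _ _)
      hKtc.stronglyMeasurable.stronglyMeasurableAtFilter hKtc.continuousAt)
  have hφc : Continuous φ := continuous_iff_continuousAt.2 fun s => (hdφ s).continuousAt
  have hinner : ∀ s ∈ Set.uIcc 0 t, ∫ r in (0 : ℝ)..t, M (t - r) * min s r = φ s := by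
    intro s hs
    rw [Set.uIcc_of_le ht] at hs
    -- The branch of `min s r` changes at `r = s`. Integration by parts on each side leaves boundary
    -- terms `s K(t - s)` that cancel.
    rw [← intervalIntegral.integral_add_adjacent_intervals (b := s)
      (Continuous.intervalIntegrable (by fun_prop) _ _)
      (Continuous.intervalIntegrable (by fun_prop) _ _)]
    have e1 : ∫ r in (0 : ℝ)..s, M (t - r) * min s r = φ s - s * K (t - s) := by
      have hd : ∀ r ∈ Set.uIcc 0 s, HasDerivAt (fun r => φ r - r * K (t - r))
          (M (t - r) * min s r) r := by
        intro r hr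
        rw [Set.uIcc_of_le hs.1] at hr
        refine ((hdφ r).sub ((hasDerivAt_id r).mul (hdK r))).congr_deriv ?_
        rw [min_eq_right hr.2]
        simp
        ring
      rw [intervalIntegral.integral_eq_sub_of_hasDerivAt hd
        (Continuous.intervalIntegrable (by fun_prop) _ _)]
      simp [hφ]
    have e2 : ∫ r in s..t, M (t - r) * min s r = s * K (t - s) := by
      have hd : ∀ r ∈ Set.uIcc s t, HasDerivAt (fun r => -(s * K (t - r)))
          (M (t - r) * min s r) r := by
        intro r hr
        rw [Set.uIcc_of_le hs.2] at hr
        refine ((hdK r).const_mul s).neg.congr_deriv ?_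
        rw [min_eq_left hr.1]
        ring
      rw [intervalIntegral.integral_eq_sub_of_hasDerivAt hd
        (Continuous.intervalIntegrable (by fun_prop) _ _)]
      simp [h.K_zero]
    rw [e1, e2]
    ring
  have hstep : ∫ s in (0 : ℝ)..t, M (t - s) * ∫ r in (0 : ℝ)..t, M (t - r) * min s r =
      ∫ s in (0 : ℝ)..t, M (t - s) * φ s :=
    intervalIntegral.integral_congr fun s hs => by simp only [hinner s hs]
  -- A second integration by parts; the boundary terms vanish because `φ 0 = 0` and `K 0 = 0`.
  have hparts : ∫ s in (0 : ℝ)..t, (M (t - s) * φ s - K (t - s) ^ 2) = 0 := by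
    have hd : ∀ s ∈ Set.uIcc 0 t, HasDerivAt (fun s => -(K (t - s) * φ s))
        (M (t - s) * φ s - K (t - s) ^ 2) s := fun s _ =>
      ((hdK s).mul (hdφ s)).neg.congr_deriv (by ring)
    rw [intervalIntegral.integral_eq_sub_of_hasDerivAt hd
      (Continuous.intervalIntegrable (by fun_prop) _ _)]
    simp [h.K_zero, hφ]
  rw [intervalIntegral.integral_sub (Continuous.intervalIntegrable (by fun_prop) _ _)
    (Continuous.intervalIntegrable (by fun_prop) _ _), sub_eq_zero] at hparts
  rw [hstep, hparts, intervalIntegral.integral_comp_sub_left (fun s => K s ^ 2)]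
  simp

end IsImpulseResponse

/-! ### Second moments of integrated processes. -/

section stochastic

variable {Ω : Type*} [MeasurableSpace Ω] {P : Measure Ω}

theorem integrable_prod_of_integral_norm_le [IsFiniteMeasure P] {Y : Type*} [MeasurableSpace Y]
    {ν : Measure Y} [IsFiniteMeasure ν] {f : Ω × Y → ℝ} (hf : Measurable f)
    (hint : ∀ᵐ y ∂ν, Integrable (fun ω => f (ω, y)) P) {C : ℝ}
    (hC : ∀ᵐ y ∂ν, ∫ ω, ‖f (ω, y)‖ ∂P ≤ C) : Integrable f (P.prod ν) := by
  refine (integrable_prod_iff' hf.aestronglyMeasurable).2 ⟨hint, ?_⟩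
  refine Integrable.of_bound (C := C) ?_ ?_
  · exact hf.norm.aestronglyMeasurable.prod_swap.integral_prod_right'
  · filter_upwards [hC] with y hy
    rwa [Real.norm_of_nonneg (integral_nonneg fun _ => norm_nonneg _)]

/-- Second moments of a time integral of a process with the covariance of Brownian motion. -/
theorem memLp_and_variance_intervalIntegral_mul [IsProbabilityMeasure P] {w : ℝ → Ω → ℝ}
    (hw : Measurable (Function.uncurry w)) (hL2 : ∀ s, MemLp (w s) 2 P)
    (hmean : ∀ s, 0 ≤ s → ∫ ω, w s ω ∂P = 0)
    (hcov : ∀ s r, 0 ≤ s → 0 ≤ r → ∫ ω, w s ω * w r ω ∂P = min s r)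
    {g : ℝ → ℝ} (hg : Continuous g) {t : ℝ} (ht : 0 ≤ t) :
    MemLp (fun ω => ∫ s in (0 : ℝ)..t, g s * w s ω) 2 P ∧
    Var[fun ω => ∫ s in (0 : ℝ)..t, g s * w s ω; P] =
      ∫ s in (0 : ℝ)..t, g s * ∫ r in (0 : ℝ)..t, g r * min s r := by
  set ν : Measure ℝ := volume.restrict (Set.Ioc 0 t) with hν
  have hX : (fun ω => ∫ s in (0 : ℝ)..t, g s * w s ω) = fun ω => ∫ s, g s * w s ω ∂ν := by
    funext ω
    rw [intervalIntegral.integral_of_le ht]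
  obtain ⟨C, hC⟩ := (isCompact_Icc (a := (0 : ℝ)) (b := t)).exists_bound_of_continuousOn
    hg.continuousOn
  have hC0 : 0 ≤ C := (norm_nonneg _).trans (hC 0 ⟨le_rfl, ht⟩)
  have hgm := hg.measurable
  have hwm : ∀ {Z : Type _} [MeasurableSpace Z] {p : Z → ℝ} {q : Z → Ω}, Measurable p →
      Measurable q → Measurable fun z => w (p z) (q z) := fun hp hq => hw.comp (hp.prodMk hq)
  have hsq : ∀ s, 0 ≤ s → ∫ ω, w s ω ^ 2 ∂P = s := by
    intro s hs
    simpa [pow_two] using hcov s s hs hs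
  have hν_mem : ∀ᵐ s ∂ν, s ∈ Set.Ioc 0 t := ae_restrict_mem measurableSet_Ioc
  have hνν_mem : ∀ᵐ y ∂ν.prod ν, y.1 ∈ Set.Ioc 0 t ∧ y.2 ∈ Set.Ioc 0 t := by
    rw [hν, Measure.prod_restrict]
    exact ae_restrict_mem (measurableSet_Ioc.prod measurableSet_Ioc)
  have hmul_int : ∀ s r, Integrable (fun ω => w s ω * w r ω) P := fun s r =>
    (hL2 s).integrable_mul (hL2 r)
  have hsq_int : ∀ s, Integrable (fun ω => w s ω ^ 2) P := fun s => (hL2 s).integrable_sq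
  have hF1 : Integrable (fun z : Ω × ℝ => g z.2 * w z.2 z.1) (P.prod ν) := by
    refine integrable_prod_of_integral_norm_le
      ((hgm.comp measurable_snd).mul (hwm measurable_snd measurable_fst))
      (Eventually.of_forall fun s => ((hL2 s).integrable one_le_two).const_mul (g s))
      (C := C * ((1 + t) / 2)) ?_
    filter_upwards [hν_mem] with s hs
    simp only [norm_mul]
    rw [integral_const_mul]
    refine mul_le_mul (hC s ⟨hs.1.le, hs.2⟩) ?_ (integral_nonneg fun _ => norm_nonneg _) hC0
    calc ∫ ω, ‖w s ω‖ ∂P ≤ ∫ ω, (1 + w s ω ^ 2) / 2 ∂P := by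
          refine integral_mono ((hL2 s).integrable one_le_two).norm
            (((integrable_const 1).add (hsq_int s)).div_const 2) fun ω => ?_
          have := sq_nonneg (‖w s ω‖ - 1)
          have h2 := sq_abs (w s ω)
          simp only [Real.norm_eq_abs] at this ⊢
          nlinarith
      _ = (1 + s) / 2 := by
          rw [integral_div, integral_add (integrable_const 1) (hsq_int s), hsq s hs.1.le]
          simp
      _ ≤ (1 + t) / 2 := by linarith [hs.2]
  -- Integrability for Fubini: the square of the time integral is a double integral, whose
  -- expectation is computed from the covariances.
  have hF2 : Integrable (fun z : Ω × (ℝ × ℝ) =>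
      (g z.2.1 * w z.2.1 z.1) * (g z.2.2 * w z.2.2 z.1)) (P.prod (ν.prod ν)) := by
    have e : ∀ (y : ℝ × ℝ) ω, (g y.1 * w y.1 ω) * (g y.2 * w y.2 ω) =
        (g y.1 * g y.2) * (w y.1 ω * w y.2 ω) := fun y ω => by ring
    refine integrable_prod_of_integral_norm_le
      (((hgm.comp (measurable_fst.comp measurable_snd)).mul
        (hwm (measurable_fst.comp measurable_snd) measurable_fst)).mul
      ((hgm.comp (measurable_snd.comp measurable_snd)).mul
        (hwm (measurable_snd.comp measurable_snd) measurable_fst)))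
      (Eventually.of_forall fun y => ?_) (C := C * C * t) ?_
    · simp only [e]
      exact (hmul_int _ _).const_mul _
    filter_upwards [hνν_mem] with y hy
    simp only [e]
    simp only [norm_mul (g _ * g _)]
    rw [integral_const_mul, norm_mul]
    refine mul_le_mul (mul_le_mul (hC _ ⟨hy.1.1.le, hy.1.2⟩) (hC _ ⟨hy.2.1.le, hy.2.2⟩)
      (norm_nonneg _) hC0) ?_ (integral_nonneg fun _ => norm_nonneg _) (mul_nonneg hC0 hC0)
    calc ∫ ω, ‖w y.1 ω * w y.2 ω‖ ∂P ≤ ∫ ω, (w y.1 ω ^ 2 + w y.2 ω ^ 2) / 2 ∂P := by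
          refine integral_mono (hmul_int _ _).norm
            (((hsq_int _).add (hsq_int _)).div_const 2) fun ω => ?_
          have h1 := sq_nonneg (|w y.1 ω| - |w y.2 ω|)
          have h2 := sq_abs (w y.1 ω)
          have h3 := sq_abs (w y.2 ω)
          simp only [Real.norm_eq_abs, abs_mul]
          nlinarith
      _ = (y.1 + y.2) / 2 := by
          rw [integral_div, integral_add (hsq_int _) (hsq_int _), hsq _ hy.1.1.le,
            hsq _ hy.2.1.le]
      _ ≤ t := by linarith [hy.1.2, hy.2.2]
  have hXsq : ∀ ω, (∫ s, g s * w s ω ∂ν) ^ 2 =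
      ∫ y, (g y.1 * w y.1 ω) * (g y.2 * w y.2 ω) ∂ν.prod ν := fun ω => by
    rw [pow_two, ← integral_prod_mul]
  have hXm : AEStronglyMeasurable (fun ω => ∫ s, g s * w s ω ∂ν) P :=
    hF1.aestronglyMeasurable.integral_prod_right'
  have hXL2 : MemLp (fun ω => ∫ s, g s * w s ω ∂ν) 2 P := by
    rw [memLp_two_iff_integrable_sq hXm]
    simp only [hXsq]
    exact hF2.integral_prod_left
  rw [hX]
  refine ⟨hXL2, ?_⟩
  have hmeanX : ∫ ω, ∫ s, g s * w s ω ∂ν ∂P = 0 := by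
    rw [integral_integral_swap hF1]
    refine integral_eq_zero_of_ae ?_
    filter_upwards [hν_mem] with s hs
    rw [integral_const_mul, hmean s hs.1.le, mul_zero]
    rfl
  rw [variance_of_integral_eq_zero hXm.aemeasurable hmeanX]
  simp only [hXsq]
  rw [integral_integral_swap hF2, integral_prod _ hF2.integral_prod_right,
    intervalIntegral.integral_of_le ht]
  refine setIntegral_congr_fun measurableSet_Ioc fun s hs => ?_
  rw [intervalIntegral.integral_of_le ht, ← integral_const_mul]
  refine setIntegral_congr_fun measurableSet_Ioc fun r hr => ?_
  rw [← hcov s r hs.1.le hr.1.le, ← integral_const_mul, ← integral_const_mul]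
  congr 1
  funext ω
  ring

theorem abs_covariance_le_variance_add [IsFiniteMeasure P] {X Y : Ω → ℝ} (hX : MemLp X 2 P)
    (hY : MemLp Y 2 P) : |cov[X, Y; P]| ≤ (Var[X; P] + Var[Y; P]) / 2 := by
  have h1 := variance_nonneg (X + Y) P
  have h2 := variance_nonneg (X - Y) P
  rw [variance_add hX hY] at h1
  rw [variance_sub hX hY] at h2
  rw [abs_le]
  constructor <;> linarith

/-- A square-integrable perturbation whose coefficients tend to `0` does not affect the limit of
the variance. -/
theorem tendsto_variance_add [IsFiniteMeasure P] {X : ℝ → Ω → ℝ} {Y Z : Ω → ℝ} {α β : ℝ → ℝ}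
    (hX : ∀ t, 0 ≤ t → MemLp (X t) 2 P) (hY : MemLp Y 2 P) (hZ : MemLp Z 2 P)
    (hα : Tendsto α atTop (𝓝 0)) (hβ : Tendsto β atTop (𝓝 0)) {c : ℝ}
    (hc : Tendsto (fun t => Var[X t; P]) atTop (𝓝 c)) :
    Tendsto (fun t => Var[fun ω => α t * Y ω + β t * Z ω + X t ω; P]) atTop (𝓝 c) := by
  -- The initial state may be correlated with the noise. Since the variances of `X t` converge,
  -- these covariances are eventually bounded and the vanishing coefficients dispose of them.
  have hsmall : ∀ {γ : ℝ → ℝ} {U : Ω → ℝ}, MemLp U 2 P → Tendsto γ atTop (𝓝 0) →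
      Tendsto (fun t => γ t * cov[U, X t; P]) atTop (𝓝 0) := by
    intro γ U hU hγ
    have h0 : Tendsto (fun t => |γ t| * ((Var[U; P] + Var[X t; P]) / 2)) atTop (𝓝 0) := by
      simpa using hγ.abs.mul ((hc.const_add Var[U; P]).div_const 2)
    refine squeeze_zero_norm' ?_ h0
    filter_upwards [eventually_ge_atTop 0] with t ht
    rw [norm_mul, Real.norm_eq_abs, Real.norm_eq_abs]
    exact mul_le_mul_of_nonneg_left (abs_covariance_le_variance_add hU (hX t ht)) (abs_nonneg _)
  have hlim : Tendsto (fun t => (α t ^ 2 * Var[Y; P] + 2 * (α t * β t * cov[Y, Z; P])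
      + β t ^ 2 * Var[Z; P]) + 2 * (α t * cov[Y, X t; P] + β t * cov[Z, X t; P]) + Var[X t; P])
      atTop (𝓝 c) := by
    have := (((((hα.pow 2).mul_const Var[Y; P]).add
      (((hα.mul hβ).mul_const cov[Y, Z; P]).const_mul 2)).add
      ((hβ.pow 2).mul_const Var[Z; P])).add
      (((hsmall hY hα).add (hsmall hZ hβ)).const_mul 2)).add hc
    simpa using this
  refine hlim.congr' ?_
  filter_upwards [eventually_ge_atTop 0] with t ht
  have hY' : MemLp (fun ω => α t * Y ω) 2 P := hY.const_mul _
  have hZ' : MemLp (fun ω => β t * Z ω) 2 P := hZ.const_mul _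
  have hYZ : MemLp (fun ω => α t * Y ω + β t * Z ω) 2 P := hY'.add hZ'
  rw [variance_fun_add hYZ (hX t ht), variance_fun_add hY' hZ', variance_const_mul,
    variance_const_mul, covariance_const_mul_left, covariance_const_mul_right]
  have e : cov[fun ω => α t * Y ω + β t * Z ω, X t; P] =
      α t * cov[Y, X t; P] + β t * cov[Z, X t; P] := by
    rw [← covariance_const_mul_left, ← covariance_const_mul_left]
    exact covariance_add_left hY' hZ' (hX t ht)
  rw [e]
  ring

end stochastic

/-! ### A single mode driven by noise. -/

section mode

variable {Ω : Type*} [MeasurableSpace Ω] {P : Measure Ω} [IsProbabilityMeasure P]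

theorem noisyOscillator_of_forall {l : ℝ} (hl : 0 < l) {a b w : ℝ≥0 → Ω → ℝ}
    (hma : ∀ t, Measurable (a t)) (hmb : ∀ t, Measurable (b t))
    (hca : ∀ ω, Continuous fun t => a t ω) (hcb : ∀ ω, Continuous fun t => b t ω)
    (ha0 : MemLp (a 0) 2 P) (hb0 : MemLp (b 0) 2 P)
    (hab : ∀ ω (t : ℝ≥0), a t ω = a 0 ω + ∫ s in (0 : ℝ)..t, b s.toNNReal ω)
    (hbw : ∀ ω (t : ℝ≥0), b t ω = b 0 ω +
      (∫ s in (0 : ℝ)..t, (-l * a s.toNNReal ω - l * b s.toNNReal ω)) + w t ω)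
    (hwL2 : ∀ t, MemLp (w t) 2 P) (hmean : ∀ t, ∫ ω, w t ω ∂P = 0)
    (hcov : ∀ s t, ∫ ω, w s ω * w t ω ∂P = min s t) :
    (∀ t, MemLp (a t) 2 P) ∧ Tendsto (fun t => Var[a t; P]) atTop (𝓝 (1 / (2 * l ^ 2))) := by
  obtain ⟨K, M, h⟩ := exists_isImpulseResponse l
  have hMc := h.continuous_M
  have hca' : ∀ ω, Continuous fun s : ℝ => a s.toNNReal ω := fun ω =>
    (hca ω).comp continuous_real_toNNReal
  have hcb' : ∀ ω, Continuous fun s : ℝ => b s.toNNReal ω := fun ω =>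
    (hcb ω).comp continuous_real_toNNReal
  -- The equation expresses the noise through the solution, from which it inherits continuous paths
  -- and hence joint measurability.
  have hwfun : ∀ (t : ℝ≥0) ω, w t ω = b t ω - b 0 ω -
      ∫ s in (0 : ℝ)..t, (-l * a s.toNNReal ω - l * b s.toNNReal ω) := fun t ω => by
    rw [hbw ω t]; ring
  have hcd : ∀ ω, Continuous fun s : ℝ => -l * a s.toNNReal ω - l * b s.toNNReal ω := fun ω => by
    have := hca' ω
    have := hcb' ω
    fun_prop
  have hcw : ∀ ω, Continuous fun t => w t ω := fun ω => by
    simp only [hwfun]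
    refine ((hcb ω).sub continuous_const).sub ?_
    exact (intervalIntegral.continuous_primitive
      (fun _ _ => (hcd ω).intervalIntegrable _ _) 0).comp NNReal.continuous_coe
  have hmd : Measurable (Function.uncurry fun (s : ℝ) ω =>
      -l * a s.toNNReal ω - l * b s.toNNReal ω) :=
    measurable_uncurry_of_continuous_of_measurable hcd fun s =>
      ((hma _).const_mul _).sub ((hmb _).const_mul _)
  have hmw : ∀ t, Measurable (w t) := fun t => by
    have : w t = fun ω => b t ω - b 0 ω -
        ∫ s in Set.Ioc (0 : ℝ) t, (-l * a s.toNNReal ω - l * b s.toNNReal ω) := by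
      funext ω
      rw [hwfun, intervalIntegral.integral_of_le t.coe_nonneg]
    rw [this]
    refine ((hmb t).sub (hmb 0)).sub ?_
    exact (hmd.stronglyMeasurable.comp_measurable
      measurable_swap).integral_prod_right'.measurable
  have hmw' : Measurable (Function.uncurry fun (s : ℝ) ω => w s.toNNReal ω) :=
    measurable_uncurry_of_continuous_of_measurable
      (fun ω => (hcw ω).comp continuous_real_toNNReal) fun s => hmw _
  set X : ℝ → Ω → ℝ := fun t ω => ∫ s in (0 : ℝ)..t, M (t - s) * w s.toNNReal ω with hX
  have hsol : ∀ t : ℝ, 0 ≤ t → a t.toNNReal =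
      fun ω => (M t + l * K t) * a 0 ω + K t * b 0 ω + X t ω := by
    intro t ht
    funext ω
    have := h.eq_of_integral_eq (w := fun s => w s.toNNReal ω) (hca' ω) (hcb' ω)
      (fun t ht => ?_) (fun t ht => ?_) ht
    · simpa using this
    · simpa [ht] using hab ω t.toNNReal
    · simpa [ht] using hbw ω t.toNNReal
  have hstoch : ∀ t : ℝ, 0 ≤ t → MemLp (X t) 2 P ∧ Var[X t; P] = ∫ s in (0 : ℝ)..t, K s ^ 2 := by
    intro t ht
    rw [← h.integral_integral_mul_min ht]
    refine memLp_and_variance_intervalIntegral_mul hmw' (fun s => hwL2 _) (fun s _ => hmean _)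
      (fun s r hs hr => ?_) (g := fun s => M (t - s)) (by fun_prop) ht
    rw [hcov, NNReal.coe_min, Real.coe_toNNReal _ hs, Real.coe_toNNReal _ hr]
  constructor
  · intro t
    have := hsol t t.2
    rw [Real.toNNReal_coe] at this
    rw [this]
    exact ((ha0.const_mul _).add (hb0.const_mul _)).add (hstoch t t.2).1
  · have hvar : Tendsto (fun t => Var[X t; P]) atTop (𝓝 (1 / (2 * l ^ 2))) :=
      (h.tendsto_integral_sq hl).congr'
        ((eventually_ge_atTop 0).mono fun t ht => (hstoch t ht).2.symm)
    have hα : Tendsto (fun t => M t + l * K t) atTop (𝓝 0) := by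
      simpa using (h.tendsto_M hl).add ((h.tendsto_K hl).const_mul l)
    have hlim := tendsto_variance_add (fun t ht => (hstoch t ht).1) ha0 hb0 hα (h.tendsto_K hl) hvar
    refine (hlim.comp (NNReal.tendsto_coe_atTop.2 tendsto_id)).congr fun t => ?_
    have := hsol t t.2
    rw [Real.toNNReal_coe] at this
    simp only [Function.comp, id, this]

/-- The position of a damped oscillator `y'' = -l y - l y'` driven by white noise has asymptotic
variance `1 / (2 l ^ 2)`. -/
theorem noisyOscillator_tendsto_variance {l : ℝ} (hl : 0 < l) {a b w : ℝ≥0 → Ω → ℝ}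
    (hma : ∀ t, Measurable (a t)) (hmb : ∀ t, Measurable (b t))
    (hca : ∀ᵐ ω ∂P, Continuous fun t => a t ω) (hcb : ∀ᵐ ω ∂P, Continuous fun t => b t ω)
    (ha0 : MemLp (a 0) 2 P) (hb0 : MemLp (b 0) 2 P)
    (hab : ∀ᵐ ω ∂P, ∀ t : ℝ≥0, a t ω = a 0 ω + ∫ s in (0 : ℝ)..t, b s.toNNReal ω)
    (hbw : ∀ᵐ ω ∂P, ∀ t : ℝ≥0, b t ω = b 0 ω +
      (∫ s in (0 : ℝ)..t, (-l * a s.toNNReal ω - l * b s.toNNReal ω)) + w t ω)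
    (hwL2 : ∀ t, MemLp (w t) 2 P) (hmean : ∀ t, ∫ ω, w t ω ∂P = 0)
    (hcov : ∀ s t, ∫ ω, w s ω * w t ω ∂P = min s t) :
    (∀ t, MemLp (a t) 2 P) ∧ Tendsto (fun t => Var[a t; P]) atTop (𝓝 (1 / (2 * l ^ 2))) := by
  -- All processes are set to `0` off a measurable set of full measure, where the zero solution
  -- satisfies the equations; no mean or covariance changes.
  obtain ⟨A, hA, hAm, hAP⟩ := (hca.and (hcb.and (hab.and hbw))).exists_measurable_mem
  have hmodif : ∀ f : Ω → ℝ, A.indicator f =ᵐ[P] f := fun f => by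
    filter_upwards [hA] with ω hω
    rw [Set.indicator_of_mem hω]
  have hmain := noisyOscillator_of_forall (P := P) hl (a := fun t => A.indicator (a t))
    (b := fun t => A.indicator (b t)) (w := fun t => A.indicator (w t))
    (fun t => (hma t).indicator hAm) (fun t => (hmb t).indicator hAm)
    (fun ω => by
      by_cases hω : ω ∈ A
      · simpa [hω] using (hAP ω hω).1
      · simpa [hω] using continuous_const)
    (fun ω => by
      by_cases hω : ω ∈ A
      · simpa [hω] using (hAP ω hω).2.1
      · simpa [hω] using continuous_const)
    (ha0.indicator hAm) (hb0.indicator hAm)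
    (fun ω t => by
      by_cases hω : ω ∈ A
      · simpa [hω] using (hAP ω hω).2.2.1 t
      · simp [hω])
    (fun ω t => by
      by_cases hω : ω ∈ A
      · simpa [hω] using (hAP ω hω).2.2.2 t
      · simp [hω])
    (fun t => (hwL2 t).indicator hAm)
    (fun t => (integral_congr_ae (hmodif _)).trans (hmean t))
    (fun s t => (integral_congr_ae ((hmodif _).mul (hmodif _))).trans (hcov s t))
  exact ⟨fun t => (memLp_congr_ae (hmodif _)).1 (hmain.1 t),
    hmain.2.congr fun t => variance_congr (hmodif _)⟩

end mode

/-! ### Decomposition of the network into modes. -/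

section consensus

open Matrix

variable {V : Type*} [Fintype V]

/-- The second moments of a linear combination, with normalized coefficients, of uncorrelated
Brownian motions are those of a Brownian motion. -/
theorem IsIntegratedWhiteNoise.sum_mul {Ω : Type*} [MeasurableSpace Ω] {P : Measure Ω}
    [IsProbabilityMeasure P] {W : V → ℝ≥0 → Ω → ℝ} (hW : IsIntegratedWhiteNoise P W) {e : V → ℝ}
    (he : ∑ i, e i ^ 2 = 1) :
    (∀ t, MemLp (fun ω => ∑ i, e i * W i t ω) 2 P) ∧ (∀ t, ∫ ω, ∑ i, e i * W i t ω ∂P = 0) ∧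
    ∀ s t, ∫ ω, (∑ i, e i * W i s ω) * (∑ i, e i * W i t ω) ∂P = min s t := by
  have hL2 : ∀ i t, MemLp (W i t) 2 P := fun i t =>
    ((hW.brownian i).hasLaw_eval t).hasGaussianLaw.memLp_two
  have hL2' : ∀ i t, MemLp (fun ω => e i * W i t ω) 2 P := fun i t => (hL2 i t).const_mul _
  have hsum : ∀ t, MemLp (fun ω => ∑ i, e i * W i t ω) 2 P := fun t =>
    memLp_finsetSum _ fun i _ => hL2' i t
  have hmean : ∀ t, ∫ ω, ∑ i, e i * W i t ω ∂P = 0 := fun t => by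
    rw [integral_finsetSum _ fun i _ => (hL2' i t).integrable one_le_two]
    refine Finset.sum_eq_zero fun i _ => ?_
    rw [integral_const_mul, (hW.brownian i).integral_eval, mul_zero]
  refine ⟨hsum, hmean, fun s t => ?_⟩
  have h1 := covariance_eq_sub (hsum s) (hsum t)
  simp only [hmean, mul_zero, sub_zero] at h1
  have h2 : ∫ ω, (∑ i, e i * W i s ω) * (∑ i, e i * W i t ω) ∂P =
    cov[fun ω => ∑ i, e i * W i s ω, fun ω => ∑ i, e i * W i t ω; P] := h1.symm
  rw [h2, covariance_fun_sum_fun_sum (fun i => hL2' i s) (fun i => hL2' i t)]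
  simp only [covariance_const_mul_left, covariance_const_mul_right]
  have h3 : ∀ i, ∑ j, e j * (e i * cov[W i s, W j t; P]) = e i ^ 2 * (min s t : ℝ≥0) := by
    intro i
    rw [Finset.sum_eq_single i (fun j _ hj => by rw [hW.uncorrelated i j hj.symm]; simp) (by simp)]
    have := (hW.brownian i).covariance_eval s t
    rw [this]
    ring
  calc _ = ∑ i, e i ^ 2 * ((min s t : ℝ≥0) : ℝ) := Finset.sum_congr rfl fun i _ => h3 i
    _ = _ := by rw [← Finset.sum_mul, he, one_mul]

variable [DecidableEq V] (G : SimpleGraph V) [DecidableRel G.Adj]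

/-- The coordinates of the eigenvectors of the Laplacian matrix. -/
noncomputable def lapEigenvector (l i : V) : ℝ := (G.isHermitian_lapMatrix ℝ).eigenvectorBasis l i

theorem sum_lapEigenvector_mul (l m : V) :
    ∑ i, lapEigenvector G l i * lapEigenvector G m i = if l = m then 1 else 0 := by
  have := orthonormal_iff_ite.1 (G.isHermitian_lapMatrix ℝ).eigenvectorBasis.orthonormal m l
  simp only [PiLp.inner_apply] at this
  simpa [lapEigenvector, eq_comm] using this

theorem sum_lapEigenvector_mul_sum (x : V → ℝ) (i : V) :
    ∑ l, lapEigenvector G l i * ∑ j, lapEigenvector G l j * x j = x i := by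
  have := congrArg (fun y => y i)
    ((G.isHermitian_lapMatrix ℝ).eigenvectorBasis.sum_repr' (WithLp.toLp 2 x))
  simp only [PiLp.inner_apply] at this
  simpa [lapEigenvector, mul_comm] using this

theorem sum_lapEigenvector_mul_lapMatrix_mulVec (x : V → ℝ) (l : V) :
    ∑ i, lapEigenvector G l i * (G.lapMatrix ℝ).mulVec x i =
      (G.isHermitian_lapMatrix ℝ).eigenvalues l * ∑ i, lapEigenvector G l i * x i := by
  have h1 : (G.lapMatrix ℝ).mulVec (lapEigenvector G l) =
      (G.isHermitian_lapMatrix ℝ).eigenvalues l • lapEigenvector G l :=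
    (G.isHermitian_lapMatrix ℝ).mulVec_eigenvectorBasis l
  calc _ = lapEigenvector G l ⬝ᵥ (G.lapMatrix ℝ).mulVec x := rfl
    _ = (G.lapMatrix ℝ).mulVec (lapEigenvector G l) ⬝ᵥ x := by
      rw [dotProduct_mulVec, ← mulVec_transpose, (G.isSymm_lapMatrix (R := ℝ)).eq]
    _ = _ := by
      rw [h1, smul_dotProduct, smul_eq_mul]
      rfl

variable {G} {Ω : Type*} [MeasurableSpace Ω] {P : Measure Ω} [IsProbabilityMeasure P]
  {W : V → ℝ≥0 → Ω → ℝ} {x v : ℝ≥0 → Ω → V → ℝ}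

theorem IsSecondOrderNoisyConsensus.mode_tendsto_variance
    (hx : IsSecondOrderNoisyConsensus G P W x v) (hW : IsIntegratedWhiteNoise P W) {l : V}
    (hl : (G.isHermitian_lapMatrix ℝ).eigenvalues l ≠ 0) :
    (∀ t, MemLp (fun ω => ∑ i, lapEigenvector G l i * x t ω i) 2 P) ∧
    Tendsto (fun t => Var[fun ω => ∑ i, lapEigenvector G l i * x t ω i; P]) atTop
      (𝓝 (1 / (2 * (G.isHermitian_lapMatrix ℝ).eigenvalues l ^ 2))) := by
  have hpos : 0 < (G.isHermitian_lapMatrix ℝ).eigenvalues l :=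
    lt_of_le_of_ne ((SimpleGraph.posSemidef_lapMatrix ℝ G).eigenvalues_nonneg l) hl.symm
  obtain ⟨hw1, hw2, hw3⟩ := hW.sum_mul (e := lapEigenvector G l)
    (by simpa [pow_two] using sum_lapEigenvector_mul G l l)
  refine noisyOscillator_tendsto_variance hpos (a := fun t ω => ∑ i, lapEigenvector G l i * x t ω i)
    (b := fun t ω => ∑ i, lapEigenvector G l i * v t ω i) (fun t => ?_) (fun t => ?_) ?_ ?_ ?_ ?_
    ?_ ?_ hw1 hw2 hw3
  · exact Finset.measurable_fun_sum _ fun i _ =>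
      ((measurable_pi_apply i).comp (hx.measurable_x t)).const_mul _
  · exact Finset.measurable_fun_sum _ fun i _ =>
      ((measurable_pi_apply i).comp (hx.measurable_v t)).const_mul _
  · filter_upwards [hx.continuous_x] with ω hω
    exact continuous_finsetSum _ fun i _ => ((continuous_apply i).comp hω).const_mul _
  · filter_upwards [hx.continuous_v] with ω hω
    exact continuous_finsetSum _ fun i _ => ((continuous_apply i).comp hω).const_mul _
  · exact memLp_finsetSum _ fun i _ => (hx.memLp_x i).const_mul _
  · exact memLp_finsetSum _ fun i _ => (hx.memLp_v i).const_mul _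
  · filter_upwards [hx.continuous_v, hx.eq_x] with ω hω h t
    have hc : ∀ i, Continuous fun s : ℝ => v s.toNNReal ω i := fun i =>
      ((continuous_apply i).comp hω).comp continuous_real_toNNReal
    rw [intervalIntegral.integral_finsetSum fun i _ =>
      ((hc i).const_mul _).intervalIntegrable _ _, ← Finset.sum_add_distrib]
    refine Finset.sum_congr rfl fun i _ => ?_
    rw [intervalIntegral.integral_const_mul, h t i]
    ring
  · filter_upwards [hx.continuous_x, hx.continuous_v, hx.eq_v] with ω hωx hωv h t
    have hcx : Continuous fun s : ℝ => x s.toNNReal ω := hωx.comp continuous_real_toNNReal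
    have hcv : Continuous fun s : ℝ => v s.toNNReal ω := hωv.comp continuous_real_toNNReal
    have hc : ∀ i, Continuous fun s : ℝ => (-((G.lapMatrix ℝ).mulVec (x s.toNNReal ω) i)
        - (G.lapMatrix ℝ).mulVec (v s.toNNReal ω) i) := fun i =>
      ((continuous_apply i).comp (continuous_const.matrix_mulVec hcx)).neg.sub
        ((continuous_apply i).comp (continuous_const.matrix_mulVec hcv))
    have e : ∀ s : ℝ, -(G.isHermitian_lapMatrix ℝ).eigenvalues l *
        ∑ i, lapEigenvector G l i * x s.toNNReal ω i -
        (G.isHermitian_lapMatrix ℝ).eigenvalues l *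
          ∑ i, lapEigenvector G l i * v s.toNNReal ω i =
        ∑ i, lapEigenvector G l i * (-((G.lapMatrix ℝ).mulVec (x s.toNNReal ω) i)
        - (G.lapMatrix ℝ).mulVec (v s.toNNReal ω) i) := by
      intro s
      simp only [mul_sub, mul_neg, Finset.sum_sub_distrib, Finset.sum_neg_distrib,
        sum_lapEigenvector_mul_lapMatrix_mulVec]
      ring
    simp only [e]
    rw [intervalIntegral.integral_finsetSum fun i _ =>
      ((hc i).const_mul _).intervalIntegrable _ _, ← Finset.sum_add_distrib,
      ← Finset.sum_add_distrib]
    refine Finset.sum_congr rfl fun i _ => ?_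
    rw [intervalIntegral.integral_const_mul, h t i]
    ring

/-- The deviations from the average in terms of the modes of the nonzero eigenvalues. -/
theorem sub_average_eq_sum_modes [Nonempty V]
    (hG : ∀ f : V → ℝ, (∀ i j, G.Adj i j → f i = f j) → ∀ i j, f i = f j) (y : V → ℝ) (i : V) :
    y i - 1 / (Fintype.card V : ℝ) * ∑ j, y j =
      ∑ l ∈ Finset.univ.filter (fun l => (G.isHermitian_lapMatrix ℝ).eigenvalues l ≠ 0),
        lapEigenvector G l i * ∑ j, lapEigenvector G l j * y j := by
  obtain ⟨l₀, hl₀⟩ := exists_eigenvalues_lapMatrix_eq_zero_iff G hG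
  have hconst : ∀ j, lapEigenvector G l₀ j = lapEigenvector G l₀ i := fun j =>
    eigenvectorBasis_apply_eq_of_eigenvalue_eq_zero G hG ((hl₀ l₀).2 rfl) j i
  have hnorm := sum_lapEigenvector_mul G l₀ l₀
  simp only [hconst, if_true, Finset.sum_const, Finset.card_univ, nsmul_eq_mul] at hnorm
  have h1 := sum_lapEigenvector_mul_sum G y i
  rw [← Finset.sum_filter_add_sum_filter_not _
    (fun l => (G.isHermitian_lapMatrix ℝ).eigenvalues l ≠ 0)] at h1
  have hs : (Finset.univ.filter fun l =>
      ¬ (G.isHermitian_lapMatrix ℝ).eigenvalues l ≠ 0) = {l₀} := by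
    ext l
    simp [hl₀]
  have hN : (Fintype.card V : ℝ) ≠ 0 := Nat.cast_ne_zero.2 Fintype.card_ne_zero
  have h3 : ∑ j, lapEigenvector G l₀ j * y j = lapEigenvector G l₀ i * ∑ j, y j := by
    rw [Finset.mul_sum]
    exact Finset.sum_congr rfl fun j _ => by rw [hconst j]
  rw [hs, Finset.sum_singleton, h3] at h1
  -- The unit kernel vector is constant with squared entries `1/N`, so projecting onto it is
  -- averaging.
  have h2 : 1 / (Fintype.card V : ℝ) = lapEigenvector G l₀ i * lapEigenvector G l₀ i := by
    rw [eq_comm, eq_div_iff hN, mul_comm, hnorm]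
  rw [h2, ← h1]
  ring

/-- In a noisy second-order consensus network on a connected graph, the mean variance of the
deviations from the average converges to the second-order coherence. -/
theorem IsSecondOrderNoisyConsensus.tendsto_meanDeviationVariance [Nonempty V]
    (hG : ∀ f : V → ℝ, (∀ i j, G.Adj i j → f i = f j) → ∀ i j, f i = f j)
    (hx : IsSecondOrderNoisyConsensus G P W x v) (hW : IsIntegratedWhiteNoise P W) :
    Tendsto (meanDeviationVariance P x) atTop (𝓝 (secondOrderCoherence G)) := by
  set S := Finset.univ.filter (fun l => (G.isHermitian_lapMatrix ℝ).eigenvalues l ≠ 0) with hS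
  set a : V → ℝ≥0 → Ω → ℝ := fun l t ω => ∑ j, lapEigenvector G l j * x t ω j with ha
  have hmode : ∀ l ∈ S, _ := fun l hl => hx.mode_tendsto_variance hW (l := l) (by simpa [hS] using hl)
  have hvar : ∀ t, meanDeviationVariance P x t =
      1 / (Fintype.card V : ℝ) * ∑ l ∈ S, Var[a l t; P] := by
    intro t
    rw [meanDeviationVariance]
    congr 1
    have h1 : ∀ i, Var[fun ω => x t ω i - 1 / (Fintype.card V : ℝ) * ∑ j, x t ω j; P] =
        ∑ l ∈ S, ∑ m ∈ S, (lapEigenvector G l i * lapEigenvector G m i) *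
          cov[a l t, a m t; P] := by
      intro i
      simp only [sub_average_eq_sum_modes hG]
      rw [variance_fun_sum' fun l hl => ((hmode l hl).1 t).const_mul _]
      refine Finset.sum_congr rfl fun l _ => Finset.sum_congr rfl fun m _ => ?_
      rw [covariance_const_mul_left, covariance_const_mul_right]
      ring
    simp only [h1]
    rw [Finset.sum_comm]
    refine Finset.sum_congr rfl fun l hl => ?_
    -- Summed over the vertices, the coefficients become inner products of eigenvectors. Covariances
    -- of distinct modes drop out whatever their values.
    rw [Finset.sum_comm]
    simp only [← Finset.sum_mul, sum_lapEigenvector_mul]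
    rw [Finset.sum_eq_single l (fun m _ hm => by simp [hm.symm]) (fun h => absurd hl h), if_pos rfl,
      one_mul, covariance_self ((hmode l hl).1 t).aemeasurable]
  have hlim : Tendsto (fun t => 1 / (Fintype.card V : ℝ) * ∑ l ∈ S, Var[a l t; P]) atTop
      (𝓝 (1 / (Fintype.card V : ℝ) *
        ∑ l ∈ S, 1 / (2 * (G.isHermitian_lapMatrix ℝ).eigenvalues l ^ 2))) :=
    (tendsto_finsetSum _ fun l hl => (hmode l hl).2).const_mul _
  have hval : secondOrderCoherence G = 1 / (Fintype.card V : ℝ) *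
      ∑ l ∈ S, 1 / (2 * (G.isHermitian_lapMatrix ℝ).eigenvalues l ^ 2) := by
    rw [secondOrderCoherence, one_div_mul_eq_div, one_div_mul_eq_div, ← div_div, Finset.sum_div]
    simp only [div_div, mul_comm _ (2 : ℝ), hS]
  rw [hval]
  exact hlim.congr fun t => (hvar t).symm

end consensus

theorem theorem5 (k : ℕ) (hk : 3 ≤ k) :
    (∀ n : ℕ, 1 ≤ n →
      (∀ (Ω : Type*) [MeasurableSpace Ω] (P : Measure Ω) [IsProbabilityMeasure P]
        (W : (Fin n → Fin k) → ℝ≥0 → Ω → ℝ) (x v : ℝ≥0 → Ω → (Fin n → Fin k) → ℝ),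
        IsIntegratedWhiteNoise P W →
        IsSecondOrderNoisyConsensus (sierpinskiGraph n k) P W x v →
        Tendsto (meanDeviationVariance P x) atTop
          (𝓝 (secondOrderCoherence (sierpinskiGraph n k)))) ∧
      secondOrderCoherence (sierpinskiGraph n k) = sierpinskiClosedForm n k) ∧
    (fun n : ℕ => secondOrderCoherence (sierpinskiGraph n k)) ~[atTop]
      (fun n : ℕ => sierpinskiLeadingCoeff k *
        (Fintype.card (Fin n → Fin k) : ℝ) ^ (2 * Real.log (k + 2) / Real.log k - 1)) := by
  have : Nonempty (Fin k) := ⟨⟨0, by omega⟩⟩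
  refine ⟨fun n _ => ⟨fun Ω _ P _ W x v hW hx => ?_, ?_⟩, secondOrderCoherence_isEquivalent hk⟩
  · exact hx.tendsto_meanDeviationVariance
      (fun f hf => eq_of_forall_sierpinskiGraph_adj n f hf) hW
  · exact secondOrderCoherence_sierpinskiGraph n k (by omega)
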